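/- For $k\in\mathbb R^3$ write $\langle k\rangle=\sqrt{1+|k|^2}$, and let $\langle k\rangle^{-M}L^\infty$ be the space of measurable $f:\mathbb R^3\to\mathbb R$ with $\|f\|_M:=\|\langle k\rangle^{M}f\|_{L^\infty(\mathbb R^3)}<\infty$. Consider the kinetic wave equation $\partial_t f=\mathcal C[f]$ on $\mathbb R^3$ with $$\mathcal C[f](k_1)=\int_{\mathbb R^9}\big(|k_1||k_2||k_3||k_4|\big)^{2\beta}\big(f_2f_3f_4+f_1f_3f_4-f_1f_2f_4-f_1f_2f_3\big)\,\delta(k_1+k_2-k_3-k_4)\,\delta\big(|k_1|^2+|k_2|^2-|k_3|^2-|k_4|^2\big)\,dk_2\,dk_3\,dk_4,$$ where $f_i=f(k_i)$; that is, $$\mathcal C[f](k_1)=\frac18\int_{\mathbb R^3\times\mathbb S^2}\big(|k_1||k_2||k_3||k_4|\big)^{2\beta}\,|k_1-k_2|\,\big(f_2f_3f_4+f_1f_3f_4-f_1f_2f_4-f_1f_2f_3\big)\,dk_2\,d\sigma,$$ with $k_3=\frac{k_1+k_2}2+\frac{|k_1-k_2|}2\sigma$ and $k_4=\frac{k_1+k_2}2-\frac{|k_1-k_2|}2\sigma$.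 For $T>0$, a strong solution on $[0,T]$ with initial datum $f_0\in\langle k\rangle^{-M}L^\infty$ is a function $f\in C([0,T];\langle k\rangle^{-M}L^\infty)$ such that, for every $t\in[0,T]$, $f(t)=f_0+\int_0^t\mathcal C[f(s)]\,ds$ almost everywhere. **Theorem.** Let $\frac14<\beta\le1$ and $M>10$. Then the equation is ill-posed in $\langle k\rangle^{-M}L^\infty$, regardless of the size of the datum: for every $\delta>0$ there is $f_0$ with $\|f_0\|_M=\delta$ such that, for no $T>0$, there is a strong solution on $[0,T]$ with initial datum $f_0$. More precisely, for $A>0$ and $N\in\mathbb N$ let $$f^{0}_{A,N}(k)=\frac{A+\cos(N|k|^2)}{(1+|k|^4)^{M/4}}.$$ There are $c>0$, $A_0>0$ and $N_0\ge1$, depending only on $\beta$ and $M$, such that for all real $A\ge A_0$ and all integers $N\ge N_0$: 1. $f^0_{A,N}\in\langle k\rangle^{-M}L^\infty$; 2. there is $B_0\in\mathbb N$ such that, for all integers $B\ge B_0$ and all $k\in\mathbb R^3$ with $|k|^2=\omega:=2\pi B/N$, one has $\big|\mathcal C[f^0_{A,N}](k)\big|\ge c\,A^2\,\omega^{2\beta-\frac12-\frac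 M2}$; 3. for every $r>0$ and every $T>0$ there is no strong solution on $[0,T]$ with initial datum $r f^0_{A,N}$. -/

import Mathlib

open MeasureTheory Filter Topology

noncomputable section

namespace KineticWave

/-- Wave vectors, with the Euclidean norm. -/
abbrev Wave : Type := EuclideanSpace ℝ (Fin 3)

/-- The unit sphere of wave vector space. -/
abbrev Sph : Type := Metric.sphere (0 : Wave) 1

/-- The surface measure of the unit sphere (of total mass `4 * π`). -/
def surface : Measure Sph := (volume : Measure Wave).toSphere

/-- The japanese bracket. -/
def bracket (k : Wave) : ℝ := Real.sqrt (1 + ‖k‖ ^ 2)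

/-- The weighted essential supremum norm. -/
def wNorm (M : ℝ) (f : Wave → ℝ) : ENNReal :=
  eLpNorm (fun k => bracket k ^ M * f k) ⊤ volume

/-- `f` is a representative of an element of the weighted `L^∞` space. -/
def MemW (M : ℝ) (f : Wave → ℝ) : Prop :=
  MemLp (fun k => bracket k ^ M * f k) ⊤ volume

/-- First outgoing wave vector. -/
def out₁ (k₁ k₂ : Wave) (σ : Sph) : Wave :=
  (1 / 2 : ℝ) • (k₁ + k₂) + (‖k₁ - k₂‖ / 2) • (σ : Wave)

/-- Second outgoing wave vector. -/
def out₂ (k₁ k₂ : Wave) (σ : Sph) : Wave :=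
  (1 / 2 : ℝ) • (k₁ + k₂) - (‖k₁ - k₂‖ / 2) • (σ : Wave)

/-- Gain minus loss: `f₁ f₂ f₃ f₄ (1/f₁ + 1/f₂ - 1/f₃ - 1/f₄)`, written as the polynomial it is. -/
def gainLoss (f₁ f₂ f₃ f₄ : ℝ) : ℝ :=
  f₂ * f₃ * f₄ + f₁ * f₃ * f₄ - f₁ * f₂ * f₄ - f₁ * f₂ * f₃

/-- The collision operator. For fixed `k₁` and `k₂`, the solutions `(k₃, k₄)` of
`k₃ + k₄ = k₁ + k₂`, `|k₃|² + |k₄|² = |k₁|² + |k₂|²` are `(out₁ k₁ k₂ σ, out₂ k₁ k₂ σ)` with `σ` on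
the unit sphere. The measure `δ(k₁ + k₂ - k₃ - k₄) δ(|k₁|² + |k₂|² - |k₃|² - |k₄|²) dk₃ dk₄` is
`|k₁ - k₂| / 8 dσ`: put `k₃ = (k₁ + k₂) / 2 + r σ`, so that `dk₃ = r² dr dσ`, and the argument of
the second `δ` is `|k₁ - k₂|² / 2 - 2 r²`, with derivative `-4 r` in `r`. -/
def collision (β : ℝ) (f : Wave → ℝ) (k₁ : Wave) : ℝ :=
  (1 / 8) * ∫ p : Wave × Sph,
    (‖k₁‖ * ‖p.1‖ * ‖out₁ k₁ p.1 p.2‖ * ‖out₂ k₁ p.1 p.2‖) ^ (2 * β) * ‖k₁ - p.1‖ *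
      gainLoss (f k₁) (f p.1) (f (out₁ k₁ p.1 p.2)) (f (out₂ k₁ p.1 p.2))
    ∂((volume : Measure Wave).prod surface)

/-- `f` is a strong solution on `[0, T]` of the kinetic wave equation with datum `f₀`: a continuous
curve in the weighted `L^∞` space that satisfies Duhamel's formula. The curve of classes is given
through a representative that is measurable in time and wave vector together (every continuous
curve has one, and any two of them agree almost everywhere in time and wave vector), so that the
time integral has a meaning for almost every wave vector. -/
structure IsStrongSolution (β M T : ℝ) (f₀ : Wave → ℝ) (f : ℝ → Wave → ℝ) : Prop where
  measurable : Measurable (Function.uncurry f)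
  mem : ∀ t ∈ Set.Icc 0 T, MemW M (f t)
  continuous : ∀ t ∈ Set.Icc 0 T,
    Tendsto (fun s => wNorm M (fun k => f s k - f t k)) (𝓝[Set.Icc 0 T] t) (𝓝 0)
  duhamel : ∀ t ∈ Set.Icc 0 T, ∀ᵐ k : Wave,
    IntervalIntegrable (fun s => collision β (f s) k) volume 0 t ∧
      f t k = f₀ k + ∫ s in (0 : ℝ)..t, collision β (f s) k

/-- The oscillating datum. -/
def datum (M A : ℝ) (N : ℕ) (k : Wave) : ℝ :=
  (A + Real.cos (N * ‖k‖ ^ 2)) / (1 + ‖k‖ ^ 4) ^ (M / 4)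

end KineticWave

end

noncomputable section

namespace KineticWave

lemma lintegral_radial_plane (F : ℝ → ENNReal) (hF : Measurable F) :
    ∫⁻ y : ℝ × ℝ, F (Real.sqrt (y.1 ^ 2 + y.2 ^ 2)) =
      ENNReal.ofReal (2 * Real.pi) * ∫⁻ r in Set.Ioi (0 : ℝ), ENNReal.ofReal r * F r := by
  rw [← lintegral_comp_polarCoord_symm, polarCoord_target, Measure.volume_eq_prod,
    ← Measure.prod_restrict]
  have h : ∀ p ∈ Set.Ioi (0 : ℝ) ×ˢ Set.Ioo (-Real.pi) Real.pi,
      ENNReal.ofReal p.1 • F (Real.sqrt ((polarCoord.symm p).1 ^ 2 + (polarCoord.symm p).2 ^ 2))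
        = ENNReal.ofReal p.1 * F p.1 := by
    rintro ⟨r, θ⟩ ⟨hr, -⟩
    have hr' : 0 < r := hr
    have : (r * Real.cos θ) ^ 2 + (r * Real.sin θ) ^ 2 = r ^ 2 := by
      linear_combination r ^ 2 * Real.cos_sq_add_sin_sq θ
    simp only [polarCoord_symm_apply, smul_eq_mul]
    rw [this, Real.sqrt_sq hr'.le]
  rw [Measure.prod_restrict,
    setLIntegral_congr_fun (measurableSet_Ioi.prod measurableSet_Ioo) h,
    ← Measure.prod_restrict, lintegral_prod _ (by fun_prop)]
  simp only [lintegral_const, Measure.restrict_apply MeasurableSet.univ, Set.univ_inter,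
    Real.volume_Ioo]
  rw [lintegral_mul_const _ (by fun_prop), mul_comm]
  congr 2
  ring

lemma lintegral_half_plane (G : ℝ → ℝ → ENNReal) (hG : Measurable (Function.uncurry G)) :
    ∫⁻ z : ℝ, ∫⁻ r in Set.Ioi (0 : ℝ), G z r =
      ∫⁻ ρ in Set.Ioi (0 : ℝ), ∫⁻ θ in Set.Ioo 0 Real.pi,
        ENNReal.ofReal ρ * G (ρ * Real.cos θ) (ρ * Real.sin θ) := by
  have hS : MeasurableSet {p : ℝ × ℝ | 0 < p.2} := measurableSet_lt measurable_const measurable_snd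
  have h1 : ∫⁻ z : ℝ, ∫⁻ r in Set.Ioi (0 : ℝ), G z r =
      ∫⁻ p : ℝ × ℝ, Set.indicator {p : ℝ × ℝ | 0 < p.2} (Function.uncurry G) p := by
    rw [Measure.volume_eq_prod, lintegral_prod _ (hG.indicator hS).aemeasurable]
    refine lintegral_congr fun z => ?_
    rw [← lintegral_indicator measurableSet_Ioi]
    rfl
  rw [h1, ← lintegral_comp_polarCoord_symm, polarCoord_target, Measure.volume_eq_prod,
    ← lintegral_indicator (measurableSet_Ioi.prod measurableSet_Ioo), lintegral_prod]
  · rw [← lintegral_indicator measurableSet_Ioi]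
    refine lintegral_congr fun ρ => ?_
    by_cases hρ : 0 < ρ
    · rw [Set.indicator_of_mem (show ρ ∈ Set.Ioi 0 from hρ),
        ← lintegral_indicator measurableSet_Ioo]
      refine lintegral_congr fun θ => ?_
      by_cases hθ : θ ∈ Set.Ioo (-Real.pi) Real.pi
      · rw [Set.indicator_of_mem (show (ρ, θ) ∈ Set.Ioi (0 : ℝ) ×ˢ Set.Ioo (-Real.pi) Real.pi from
          ⟨hρ, hθ⟩)]
        by_cases hθ' : 0 < θ
        · have hs : 0 < ρ * Real.sin θ := mul_pos hρ (Real.sin_pos_of_pos_of_lt_pi hθ' hθ.2)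
          rw [Set.indicator_of_mem (show θ ∈ Set.Ioo 0 Real.pi from ⟨hθ', hθ.2⟩)]
          simp [polarCoord_symm_apply, Set.indicator, hs]
        · have hs : ¬ 0 < ρ * Real.sin θ := by
            have := Real.sin_nonpos_of_nonpos_of_neg_pi_le (not_lt.1 hθ') hθ.1.le
            nlinarith
          rw [Set.indicator_of_notMem (show θ ∉ Set.Ioo 0 Real.pi from fun h => hθ' h.1)]
          simp [polarCoord_symm_apply, Set.indicator, hs]
      · rw [Set.indicator_of_notMem (fun h => hθ h.2),
          Set.indicator_of_notMem (fun h => hθ ⟨by linarith [h.1, Real.pi_pos], h.2⟩)]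
    · rw [Set.indicator_of_notMem (show ρ ∉ Set.Ioi 0 from hρ)]
      simp [Set.indicator, hρ]
  · refine (Measurable.indicator ?_ (measurableSet_Ioi.prod measurableSet_Ioo)).aemeasurable
    have hp : Measurable fun p : ℝ × ℝ => polarCoord.symm p := by
      simp only [polarCoord_symm_apply]
      fun_prop
    exact Measurable.smul (f := fun p : ℝ × ℝ => ENNReal.ofReal p.1) (by fun_prop)
      ((hG.indicator hS).comp hp)

lemma lintegral_cos (φ : ℝ → ENNReal) :
    ∫⁻ θ in Set.Ioo 0 Real.pi, ENNReal.ofReal (Real.sin θ) * φ (Real.cos θ) =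
      ∫⁻ s in Set.Icc (-1 : ℝ) 1, φ s := by
  have himg : Real.cos '' Set.Icc 0 Real.pi = Set.Icc (-1) 1 :=
    Real.bijOn_cos.image_eq
  rw [← himg, lintegral_image_eq_lintegral_abs_deriv_mul measurableSet_Icc
    (fun x _ => (Real.hasDerivAt_cos x).hasDerivWithinAt) Real.injOn_cos,
    setLIntegral_congr Ioo_ae_eq_Icc]
  refine setLIntegral_congr_fun measurableSet_Icc fun θ hθ => ?_
  have := Real.sin_nonneg_of_nonneg_of_le_pi hθ.1 hθ.2
  simp only [abs_neg, abs_of_nonneg this]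

lemma lintegral_axial (e : Wave) (he : ‖e‖ = 1) (F : ℝ → ℝ → ENNReal)
    (hF : Measurable (Function.uncurry F)) :
    ∫⁻ x : Wave, F (inner ℝ e x) ‖x‖ =
      ∫⁻ z : ℝ, ∫⁻ y : ℝ × ℝ, F z (Real.sqrt (z ^ 2 + (y.1 ^ 2 + y.2 ^ 2))) := by
  obtain ⟨b, hb⟩ := Orthonormal.exists_orthonormalBasis_extension_of_card_eq (𝕜 := ℝ) (E := Wave)
    (ι := Fin 3) (by simp) (v := fun _ => e) (s := {0})
    ⟨fun i => he, fun i j hij => absurd (Subsingleton.elim i j) hij⟩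
  have hb0 : b 0 = e := hb 0 rfl
  have h1 : ∀ x : Wave, F (inner ℝ e x) ‖x‖ =
      (fun y : Wave => F (y 0) ‖y‖) (b.repr x) := by
    intro x
    simp only [LinearIsometryEquiv.norm_map, OrthonormalBasis.repr_apply_apply, hb0]
  have hm : Measurable fun y : Wave => F (y 0) ‖y‖ :=
    hF.comp (Measurable.prodMk (by fun_prop) (by fun_prop))
  simp_rw [h1]
  rw [b.measurePreserving_repr.lintegral_comp hm,
    ← (PiLp.volume_preserving_toLp (Fin 3)).lintegral_comp hm]
  have h2 : ∀ x : Fin 3 → ℝ, (fun y : Wave => F (y 0) ‖y‖) (WithLp.toLp 2 x) =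
      (fun p : ℝ × (Fin 2 → ℝ) => F p.1 (Real.sqrt (p.1 ^ 2 + (p.2 0 ^ 2 + p.2 1 ^ 2))))
        (MeasurableEquiv.piFinSuccAbove (fun _ => ℝ) 0 x) := by
    intro x
    simp [EuclideanSpace.norm_eq, Fin.sum_univ_three, MeasurableEquiv.piFinSuccAbove,
      Fin.insertNthEquiv, add_assoc, Fin.tail]
  have hm2 : Measurable
      (fun p : ℝ × (Fin 2 → ℝ) => F p.1 (Real.sqrt (p.1 ^ 2 + (p.2 0 ^ 2 + p.2 1 ^ 2)))) :=
    hF.comp (Measurable.prodMk (by fun_prop) (by fun_prop))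
  simp_rw [h2]
  rw [(volume_preserving_piFinSuccAbove (fun _ : Fin 3 => ℝ) 0).lintegral_comp hm2,
    Measure.volume_eq_prod, lintegral_prod _ hm2.aemeasurable]
  refine lintegral_congr fun z => ?_
  have hm3 : Measurable fun y : ℝ × ℝ => F z (Real.sqrt (z ^ 2 + (y.1 ^ 2 + y.2 ^ 2))) :=
    hF.comp (Measurable.prodMk (by fun_prop) (by fun_prop))
  rw [← (volume_preserving_finTwoArrow ℝ).lintegral_comp hm3]
  rfl

/-- Archimedes' theorem: the height above a plane is uniformly distributed on the sphere. -/
theorem lintegral_surface_inner (e : Wave) (he : ‖e‖ = 1) (φ : ℝ → ENNReal) (hφ : Measurable φ) :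
    ∫⁻ σ : Sph, φ (inner ℝ e (σ : Wave)) ∂surface =
      ENNReal.ofReal (2 * Real.pi) * ∫⁻ s in Set.Icc (-1 : ℝ) 1, φ s := by
  set F : ℝ → ℝ → ENNReal := fun z ρ => φ (z / ρ) * (Set.Iio (1 : ℝ)).indicator 1 ρ with hF
  have hind : Measurable ((Set.Iio (1 : ℝ)).indicator (1 : ℝ → ENNReal)) :=
    measurable_one.indicator measurableSet_Iio
  have hFm : Measurable (Function.uncurry F) :=
    (hφ.comp (by fun_prop)).mul (hind.comp measurable_snd)
  have hmass : ∫⁻ ρ in Set.Ioi (0 : ℝ), ENNReal.ofReal (ρ ^ 2) * (Set.Iio (1 : ℝ)).indicator 1 ρ =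
      ENNReal.ofReal (1 / 3) := by
    have := Measure.volumeIoiPow_apply_Iio 2 ⟨1, Set.mem_Ioi.2 one_pos⟩
    rw [Measure.volumeIoiPow, withDensity_apply _ measurableSet_Iio,
      setLIntegral_subtype measurableSet_Ioi _ fun a : ℝ ↦ .ofReal (a ^ 2),
      Set.image_subtype_val_Ioi_Iio] at this
    rw [← lintegral_indicator measurableSet_Ioi]
    rw [← lintegral_indicator measurableSet_Ioo] at this
    have h3 : ((1 : ℝ) ^ (2 + 1) / ((2 : ℕ) + 1)) = 1 / 3 := by norm_num
    rw [← h3]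
    refine Eq.trans (lintegral_congr fun ρ => ?_) this
    by_cases h0 : 0 < ρ <;> by_cases h1 : ρ < 1 <;> simp [h0, h1]
  have hA : ∫⁻ x : Wave, F (inner ℝ e x) ‖x‖ =
      (∫⁻ σ : Sph, φ (inner ℝ e (σ : Wave)) ∂surface) * ENNReal.ofReal (1 / 3) := by
    have hmp := (volume : Measure Wave).measurePreserving_homeomorphUnitSphereProd
    have hm : Measurable fun p : Sph × Set.Ioi (0 : ℝ) =>
        φ (inner ℝ e (p.1 : Wave)) * (Set.Iio (1 : ℝ)).indicator 1 (p.2 : ℝ) :=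
      (hφ.comp (by fun_prop)).mul (hind.comp (by fun_prop))
    have h1 : ∫⁻ x : Wave, F (inner ℝ e x) ‖x‖ =
        ∫⁻ x : ({(0 : Wave)}ᶜ : Set Wave), F (inner ℝ e (x : Wave)) ‖(x : Wave)‖
          ∂(Measure.comap (↑) (volume : Measure Wave)) := by
      rw [lintegral_subtype_comap (measurableSet_singleton _).compl
        fun x : Wave => F (inner ℝ e x) ‖x‖, restrict_compl_singleton]
    have h2 : ∀ x : ({(0 : Wave)}ᶜ : Set Wave), F (inner ℝ e (x : Wave)) ‖(x : Wave)‖ =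
        (fun p : Sph × Set.Ioi (0 : ℝ) =>
          φ (inner ℝ e (p.1 : Wave)) * (Set.Iio (1 : ℝ)).indicator 1 (p.2 : ℝ))
            (homeomorphUnitSphereProd Wave x) := by
      intro x
      simp only [hF, homeomorphUnitSphereProd_apply_fst_coe, homeomorphUnitSphereProd_apply_snd_coe,
        inner_smul_right, div_eq_inv_mul]
    have hm1 : Measurable fun σ : Sph => φ (inner ℝ e (σ : Wave)) := hφ.comp (by fun_prop)
    have hm2 : Measurable fun ρ : Set.Ioi (0 : ℝ) =>
        (Set.Iio (1 : ℝ)).indicator (1 : ℝ → ENNReal) (ρ : ℝ) := hind.comp (by fun_prop)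
    rw [h1, lintegral_congr h2, hmp.lintegral_comp hm,
      lintegral_prod_mul (f := fun σ : Sph => φ (inner ℝ e (σ : Wave)))
        (g := fun ρ : Set.Ioi (0 : ℝ) => (Set.Iio (1 : ℝ)).indicator (1 : ℝ → ENNReal) (ρ : ℝ))
        hm1.aemeasurable hm2.aemeasurable]
    congr 1
    rw [← hmass, Measure.volumeIoiPow]
    simp only [finrank_euclideanSpace, Fintype.card_fin]
    rw [lintegral_withDensity_eq_lintegral_mul _ (by fun_prop) hm2,
      ← lintegral_subtype_comap measurableSet_Ioi
        (fun ρ : ℝ => ENNReal.ofReal (ρ ^ 2) * (Set.Iio (1 : ℝ)).indicator 1 ρ)]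
    rfl
  have hB : ∫⁻ x : Wave, F (inner ℝ e x) ‖x‖ =
      (ENNReal.ofReal (2 * Real.pi) * ∫⁻ s in Set.Icc (-1 : ℝ) 1, φ s) *
        ENNReal.ofReal (1 / 3) := by
    rw [lintegral_axial e he F hFm]
    have h1 : ∀ z : ℝ, ∫⁻ y : ℝ × ℝ, F z (Real.sqrt (z ^ 2 + (y.1 ^ 2 + y.2 ^ 2))) =
        ENNReal.ofReal (2 * Real.pi) * ∫⁻ r in Set.Ioi (0 : ℝ), ENNReal.ofReal r *
          F z (Real.sqrt (z ^ 2 + r ^ 2)) := by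
      intro z
      rw [← lintegral_radial_plane (fun r => F z (Real.sqrt (z ^ 2 + r ^ 2)))
        (hFm.comp (Measurable.prodMk (by fun_prop) (by fun_prop)))]
      refine lintegral_congr fun y => ?_
      rw [Real.sq_sqrt (by positivity)]
    have hm : Measurable (Function.uncurry fun z r : ℝ =>
        ENNReal.ofReal r * F z (Real.sqrt (z ^ 2 + r ^ 2))) :=
      Measurable.mul (by fun_prop) (hFm.comp (g := Function.uncurry F)
        (f := fun p : ℝ × ℝ => (p.1, Real.sqrt (p.1 ^ 2 + p.2 ^ 2))) (by fun_prop))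
    rw [lintegral_congr h1, lintegral_const_mul _ (Measurable.lintegral_prod_right hm),
      lintegral_half_plane (fun z r => ENNReal.ofReal r * F z (Real.sqrt (z ^ 2 + r ^ 2))) hm,
      mul_assoc]
    congr 1
    rw [← hmass, ← lintegral_const_mul _ (by fun_prop)]
    refine setLIntegral_congr_fun measurableSet_Ioi fun ρ hρ => ?_
    have hρ' : 0 < ρ := hρ
    rw [← lintegral_cos, ← lintegral_mul_const _ (by fun_prop)]
    refine lintegral_congr fun θ => ?_
    have : (ρ * Real.cos θ) ^ 2 + (ρ * Real.sin θ) ^ 2 = ρ ^ 2 := by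
      linear_combination ρ ^ 2 * Real.cos_sq_add_sin_sq θ
    simp only [hF]
    rw [this, Real.sqrt_sq hρ'.le, mul_div_cancel_left₀ _ hρ'.ne', ENNReal.ofReal_mul hρ'.le,
      pow_two, ENNReal.ofReal_mul hρ'.le]
    ring
  have h3 : ENNReal.ofReal (1 / 3) ≠ 0 := by simp
  exact (ENNReal.mul_left_inj h3 ENNReal.ofReal_ne_top).1 (hA.symm.trans hB)

lemma lintegral_inv_sq_affine (a b : ℝ) (hab : |b| < a) :
    ∫⁻ s in Set.Icc (-1 : ℝ) 1, ENNReal.ofReal (((a - b * s) ^ 2)⁻¹) =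
      ENNReal.ofReal (2 / (a ^ 2 - b ^ 2)) := by
  obtain ⟨h1, h2⟩ := abs_lt.1 hab
  have ha : 0 < a := (abs_nonneg b).trans_lt hab
  have hpos : ∀ s ∈ Set.Icc (-1 : ℝ) 1, 0 < a - b * s := by
    intro s hs
    have : |b * s| ≤ |b| := by
      rw [abs_mul]
      exact mul_le_of_le_one_right (abs_nonneg _) (abs_le.2 hs)
    linarith [le_abs_self (b * s)]
  have hcont : ContinuousOn (fun s => ((a - b * s) ^ 2)⁻¹) (Set.Icc (-1 : ℝ) 1) := by
    refine ContinuousOn.inv₀ (by fun_prop) fun s hs => ?_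
    have := hpos s hs
    positivity
  rw [← ofReal_integral_eq_lintegral_ofReal hcont.integrableOn_Icc
    (Eventually.of_forall fun s => by positivity), integral_Icc_eq_integral_Ioc,
    ← intervalIntegral.integral_of_le (by norm_num)]
  congr 1
  have hder : ∀ s ∈ Set.uIcc (-1 : ℝ) 1,
      HasDerivAt (fun s => s / (a * (a - b * s))) ((a - b * s) ^ 2)⁻¹ s := by
    intro s hs
    rw [Set.uIcc_of_le (by norm_num)] at hs
    have := hpos s hs
    have hd : HasDerivAt (fun s => a * (a - b * s)) (a * (-b)) s := by
      simpa using (((hasDerivAt_id s).const_mul b).const_sub a).const_mul a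
    have hq := (hasDerivAt_id' s).fun_div hd (by positivity)
    refine hq.congr_deriv ?_
    field_simp
    ring
  rw [intervalIntegral.integral_eq_sub_of_hasDerivAt hder]
  · have h3 : 0 < a - b := by linarith
    have h4 : 0 < a + b := by linarith
    have h5 : a ^ 2 - b ^ 2 = (a - b) * (a + b) := by ring
    rw [h5, mul_one, show a - b * -1 = a + b by ring]
    field_simp
    ring
  · refine ContinuousOn.intervalIntegrable ?_
    rwa [Set.uIcc_of_le (by norm_num)]

lemma exists_unit_smul (c : Wave) : ∃ e : Wave, ‖e‖ = 1 ∧ c = ‖c‖ • e := by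
  by_cases hc : c = 0
  · obtain ⟨e, he⟩ := exists_norm_eq Wave (zero_le_one (α := ℝ))
    exact ⟨e, he, by simp [hc]⟩
  · have : ‖c‖ ≠ 0 := norm_ne_zero_iff.2 hc
    exact ⟨‖c‖⁻¹ • c, by simp [norm_smul, this], by simp [smul_smul, this]⟩

lemma norm_sphere (σ : Sph) : ‖(σ : Wave)‖ = 1 := by simp

lemma norm_sub_smul_sq (c e : Wave) (hc : c = ‖c‖ • e) (r : ℝ) (σ : Sph) :
    ‖c - r • (σ : Wave)‖ ^ 2 = ‖c‖ ^ 2 + r ^ 2 - 2 * r * ‖c‖ * inner ℝ e (σ : Wave) := by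
  have h : inner ℝ c (σ : Wave) = ‖c‖ * inner ℝ e (σ : Wave) := by
    conv_lhs => rw [hc]
    rw [inner_smul_left]; simp
  rw [norm_sub_sq_real, inner_smul_right, h, norm_smul, norm_sphere, mul_one, Real.norm_eq_abs,
    sq_abs]
  ring

lemma lintegral_surface_inv_sq_le (c : Wave) (r : ℝ) :
    ∫⁻ σ : Sph, ENNReal.ofReal (((1 + ‖c - r • (σ : Wave)‖ ^ 2) ^ 2)⁻¹) ∂surface ≤
      ENNReal.ofReal (4 * Real.pi / (1 + r ^ 2)) := by
  obtain ⟨e, he, hc⟩ := exists_unit_smul c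
  set a := 1 + ‖c‖ ^ 2 + r ^ 2 with ha
  set b := 2 * r * ‖c‖ with hb
  have hab : |b| < a := by
    rw [abs_lt]
    constructor <;> nlinarith [sq_nonneg (r - ‖c‖), sq_nonneg (r + ‖c‖)]
  have h1 : ∀ σ : Sph, ENNReal.ofReal (((1 + ‖c - r • (σ : Wave)‖ ^ 2) ^ 2)⁻¹) =
      (fun s : ℝ => ENNReal.ofReal (((a - b * s) ^ 2)⁻¹)) (inner ℝ e (σ : Wave)) := by
    intro σ
    simp only [norm_sub_smul_sq c e hc r σ, ha, hb]
    congr 3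
    ring
  rw [lintegral_congr h1, lintegral_surface_inner e he
      (fun s : ℝ => ENNReal.ofReal (((a - b * s) ^ 2)⁻¹)) (by fun_prop),
    lintegral_inv_sq_affine a b hab, ← ENNReal.ofReal_mul (by positivity)]
  refine ENNReal.ofReal_le_ofReal ?_
  have h2 : 1 + r ^ 2 ≤ a ^ 2 - b ^ 2 := by
    have : a ^ 2 - b ^ 2 = (1 + (‖c‖ - r) ^ 2) * (1 + (‖c‖ + r) ^ 2) := by rw [ha, hb]; ring
    rw [this]
    nlinarith [sq_nonneg (‖c‖ - r), sq_nonneg (‖c‖ + r), sq_nonneg ‖c‖,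
      mul_nonneg (sq_nonneg (‖c‖ - r)) (sq_nonneg (‖c‖ + r))]
  have h3 : 2 * Real.pi * (2 / (a ^ 2 - b ^ 2)) = 4 * Real.pi / (a ^ 2 - b ^ 2) := by ring
  rw [h3]
  gcongr

lemma bracket_sq (k : Wave) : bracket k ^ 2 = 1 + ‖k‖ ^ 2 := Real.sq_sqrt (by positivity)

lemma one_le_bracket (k : Wave) : 1 ≤ bracket k := by
  rw [bracket, Real.one_le_sqrt]
  nlinarith [sq_nonneg ‖k‖]

lemma bracket_pos (k : Wave) : 0 < bracket k := one_pos.trans_le (one_le_bracket k)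

lemma norm_le_bracket (k : Wave) : ‖k‖ ≤ bracket k := Real.le_sqrt_of_sq_le (by linarith)

@[fun_prop]
lemma measurable_bracket : Measurable bracket := by
  unfold bracket
  fun_prop

lemma bracket_le_mul (k₁ k₂ : Wave) : bracket k₁ ≤ 2 * (bracket k₂ * bracket (k₁ - k₂)) := by
  have h := norm_le_norm_add_norm_sub' k₁ k₂
  have h2 : ‖k₁‖ ^ 2 ≤ (‖k₂‖ + ‖k₁ - k₂‖) ^ 2 := by gcongr
  refine Real.sqrt_le_iff.2 ⟨by have := bracket_pos k₂; have := bracket_pos (k₁ - k₂); positivity, ?_⟩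
  rw [mul_pow, mul_pow, bracket_sq, bracket_sq]
  nlinarith [sq_nonneg (‖k₂‖ - ‖k₁ - k₂‖), mul_nonneg (sq_nonneg ‖k₂‖) (sq_nonneg ‖k₁ - k₂‖),
    sq_nonneg ‖k₂‖, sq_nonneg ‖k₁ - k₂‖]

lemma integrable_bracket_rpow {p : ℝ} (hp : 3 < p) :
    Integrable (fun k : Wave => bracket k ^ (-p)) := by
  have := integrable_rpow_neg_one_add_norm_sq (E := Wave) (μ := volume) (r := p) (by simpa using hp)
  refine this.congr (Eventually.of_forall fun k => ?_)
  simp only [bracket, Real.sqrt_eq_rpow]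
  rw [← Real.rpow_mul (by positivity)]
  congr 1
  ring

/-- Integrability over the collision manifold. -/
lemma exists_lintegral_le_inv_bracket {p : ℝ} (hp : 4 < p) :
    ∃ K : ℝ, 0 < K ∧ ∀ (k₁ : Wave) (ε : ℝ), |ε| = 1 →
      ∫⁻ q : Wave × Sph, ENNReal.ofReal (‖k₁ - q.1‖ * bracket q.1 ^ (-p) *
        ((1 + ‖(1 / 2 : ℝ) • (k₁ + q.1) - (ε * (‖k₁ - q.1‖ / 2)) • (q.2 : Wave)‖ ^ 2) ^ 2)⁻¹)
        ∂((volume : Measure Wave).prod surface) ≤ ENNReal.ofReal (K * (bracket k₁)⁻¹) := by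
  have hint := integrable_bracket_rpow (p := p - 1) (by linarith)
  set I := ∫ k : Wave, bracket k ^ (-(p - 1)) with hI
  have hI0 : 0 ≤ I := integral_nonneg fun k => Real.rpow_nonneg (bracket_pos k).le _
  refine ⟨32 * Real.pi * I + 1, by positivity, fun k₁ ε hε => ?_⟩
  have hε2 : ε ^ 2 = 1 := by rw [← sq_abs, hε, one_pow]
  have : SFinite surface := by unfold surface; infer_instance
  rw [lintegral_prod _ (by fun_prop)]
  have h1 : ∀ k₂ : Wave, ∫⁻ σ : Sph, ENNReal.ofReal (‖k₁ - k₂‖ * bracket k₂ ^ (-p) *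
        ((1 + ‖(1 / 2 : ℝ) • (k₁ + k₂) - (ε * (‖k₁ - k₂‖ / 2)) • (σ : Wave)‖ ^ 2) ^ 2)⁻¹) ∂surface ≤
      ENNReal.ofReal ((32 * Real.pi * (bracket k₁)⁻¹) * bracket k₂ ^ (-(p - 1))) := by
    intro k₂
    have hb1 := bracket_pos k₁
    have hb2 := bracket_pos k₂
    have hb := bracket_pos (k₁ - k₂)
    have hn : 0 ≤ ‖k₁ - k₂‖ * bracket k₂ ^ (-p) := by positivity
    simp_rw [ENNReal.ofReal_mul hn]
    rw [lintegral_const_mul _ (by fun_prop)]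
    refine (mul_le_mul_right (lintegral_surface_inv_sq_le _ _) _).trans ?_
    rw [← ENNReal.ofReal_mul hn]
    refine ENNReal.ofReal_le_ofReal ?_
    rw [mul_pow, hε2, one_mul]
    have h2 : ‖k₁ - k₂‖ * (4 * Real.pi / (1 + (‖k₁ - k₂‖ / 2) ^ 2)) ≤
        16 * Real.pi * (bracket (k₁ - k₂))⁻¹ := by
      have h3 := norm_le_bracket (k₁ - k₂)
      have h4 := bracket_sq (k₁ - k₂)
      calc ‖k₁ - k₂‖ * (4 * Real.pi / (1 + (‖k₁ - k₂‖ / 2) ^ 2))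
          ≤ bracket (k₁ - k₂) * (4 * Real.pi / (bracket (k₁ - k₂) ^ 2 / 4)) := by
            gcongr
            rw [h4]; linarith
        _ = _ := by field_simp; ring
    have h5 : (bracket (k₁ - k₂))⁻¹ ≤ 2 * bracket k₂ * (bracket k₁)⁻¹ := by
      have := bracket_le_mul k₁ k₂
      rw [inv_le_iff_one_le_mul₀ hb, ← div_eq_mul_inv, div_mul_eq_mul_div, one_le_div hb1]
      linarith
    have h6 : bracket k₂ ^ (-(p - 1)) = bracket k₂ ^ (-p) * bracket k₂ := by
      rw [← Real.rpow_add_one hb2.ne']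
      congr 1; ring
    calc ‖k₁ - k₂‖ * bracket k₂ ^ (-p) * (4 * Real.pi / (1 + (‖k₁ - k₂‖ / 2) ^ 2))
        = bracket k₂ ^ (-p) * (‖k₁ - k₂‖ * (4 * Real.pi / (1 + (‖k₁ - k₂‖ / 2) ^ 2))) := by ring
      _ ≤ bracket k₂ ^ (-p) * (16 * Real.pi * (2 * bracket k₂ * (bracket k₁)⁻¹)) := by
          refine mul_le_mul_of_nonneg_left (h2.trans ?_) (by positivity)
          exact mul_le_mul_of_nonneg_left h5 (by positivity)
      _ = _ := by rw [h6]; ring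
  refine (lintegral_mono h1).trans ?_
  have hb1 := bracket_pos k₁
  rw [← ofReal_integral_eq_lintegral_ofReal (hint.const_mul _)
    (Eventually.of_forall fun k => mul_nonneg (by positivity) (Real.rpow_nonneg (bracket_pos k).le _)),
    integral_const_mul]
  refine ENNReal.ofReal_le_ofReal ?_
  rw [← hI]
  have : 0 ≤ (bracket k₁)⁻¹ := by positivity
  nlinarith

/-- The kernel of the collision operator. -/
def kern (β : ℝ) (k₁ : Wave) (q : Wave × Sph) : ℝ :=
  (‖k₁‖ * ‖q.1‖ * ‖out₁ k₁ q.1 q.2‖ * ‖out₂ k₁ q.1 q.2‖) ^ (2 * β) * ‖k₁ - q.1‖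

/-- The weight which dominates the collision integrand. -/
def weight (M : ℝ) (k₁ : Wave) (q : Wave × Sph) : ℝ :=
  bracket q.1 ^ (2 - M) *
    (bracket (out₁ k₁ q.1 q.2) ^ (2 - M) + bracket (out₂ k₁ q.1 q.2) ^ (2 - M))

@[fun_prop]
lemma measurable_out₁ : Measurable fun p : Wave × Wave × Sph => out₁ p.1 p.2.1 p.2.2 := by
  unfold out₁
  fun_prop

@[fun_prop]
lemma measurable_out₂ : Measurable fun p : Wave × Wave × Sph => out₂ p.1 p.2.1 p.2.2 := by
  unfold out₂
  fun_prop

lemma kern_nonneg (β : ℝ) (k₁ : Wave) (q : Wave × Sph) : 0 ≤ kern β k₁ q := by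
  unfold kern
  positivity

lemma weight_nonneg (M : ℝ) (k₁ : Wave) (q : Wave × Sph) : 0 ≤ weight M k₁ q := by
  have h1 := bracket_pos q.1
  have h2 := bracket_pos (out₁ k₁ q.1 q.2)
  have h3 := bracket_pos (out₂ k₁ q.1 q.2)
  unfold weight
  positivity

lemma energy (k₁ k₂ : Wave) (σ : Sph) :
    ‖out₁ k₁ k₂ σ‖ ^ 2 + ‖out₂ k₁ k₂ σ‖ ^ 2 = ‖k₁‖ ^ 2 + ‖k₂‖ ^ 2 := by
  have h := parallelogram_law_with_norm ℝ ((1 / 2 : ℝ) • (k₁ + k₂)) ((‖k₁ - k₂‖ / 2) • (σ : Wave))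
  have h2 := parallelogram_law_with_norm ℝ k₁ k₂
  have h3 : ‖(1 / 2 : ℝ) • (k₁ + k₂)‖ = ‖k₁ + k₂‖ / 2 := by
    rw [norm_smul]; norm_num; ring
  have h4 : ‖(‖k₁ - k₂‖ / 2) • (σ : Wave)‖ = ‖k₁ - k₂‖ / 2 := by
    rw [norm_smul, norm_sphere]; simp
  rw [h3, h4] at h
  simp only [out₁, out₂]
  nlinarith

lemma le_bracket_mul {x y : ℝ} {k₁ k₂ : Wave} (h : x ^ 2 + y ^ 2 = ‖k₁‖ ^ 2 + ‖k₂‖ ^ 2) :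
    x ≤ bracket k₁ * bracket k₂ := by
  refine le_of_sq_le_sq ?_ (mul_pos (bracket_pos _) (bracket_pos _)).le
  rw [mul_pow, bracket_sq, bracket_sq]
  nlinarith [sq_nonneg y, mul_nonneg (sq_nonneg ‖k₁‖) (sq_nonneg ‖k₂‖)]

lemma kern_mul_rpow_le {β M : ℝ} (hβ : 0 ≤ β) (hβ' : β ≤ 1) (hM : 10 < M) (k₁ k₂ x y : Wave)
    (d : ℝ) (hd : 0 ≤ d) (h : ‖x‖ ^ 2 + ‖y‖ ^ 2 = ‖k₁‖ ^ 2 + ‖k₂‖ ^ 2) :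
    (‖k₁‖ * ‖k₂‖ * ‖x‖ * ‖y‖) ^ (2 * β) * d * (bracket k₂ ^ (2 - M) * bracket y ^ (2 - M)) ≤
      bracket k₁ ^ (4 * β) * (d * bracket k₂ ^ (-(M - 2 - 4 * β)) * ((1 + ‖y‖ ^ 2) ^ 2)⁻¹) := by
  have hb1 := bracket_pos k₁
  have hb2 := bracket_pos k₂
  have hb := bracket_pos y
  have h1 : (‖k₁‖ * ‖k₂‖ * ‖x‖ * ‖y‖) ^ (2 * β) ≤
      bracket k₁ ^ (4 * β) * bracket k₂ ^ (4 * β) * bracket y ^ (2 * β) := by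
    calc (‖k₁‖ * ‖k₂‖ * ‖x‖ * ‖y‖) ^ (2 * β)
        ≤ (bracket k₁ * bracket k₂ * (bracket k₁ * bracket k₂) * bracket y) ^ (2 * β) := by
          refine Real.rpow_le_rpow (by positivity) ?_ (by positivity)
          exact mul_le_mul (mul_le_mul (mul_le_mul (norm_le_bracket _) (norm_le_bracket _)
            (norm_nonneg _) hb1.le) (le_bracket_mul h) (norm_nonneg _) (by positivity))
            (norm_le_bracket _) (norm_nonneg _) (by positivity)
      _ = _ := by
          rw [show bracket k₁ * bracket k₂ * (bracket k₁ * bracket k₂) * bracket y =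
            bracket k₁ ^ (2 : ℝ) * bracket k₂ ^ (2 : ℝ) * bracket y by
              rw [Real.rpow_two, Real.rpow_two]; ring,
            Real.mul_rpow (by positivity) hb.le, Real.mul_rpow (by positivity) (by positivity),
            ← Real.rpow_mul hb1.le, ← Real.rpow_mul hb2.le]
          ring_nf
  have h2 : bracket y ^ (2 * β) * bracket y ^ (2 - M) ≤ ((1 + ‖y‖ ^ 2) ^ 2)⁻¹ := by
    rw [← bracket_sq, ← pow_mul, ← Real.rpow_add hb, ← Real.rpow_natCast, ← Real.rpow_neg hb.le]
    refine Real.rpow_le_rpow_of_exponent_le (one_le_bracket y) ?_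
    push_cast
    linarith
  have h3 : bracket k₂ ^ (-(M - 2 - 4 * β)) = bracket k₂ ^ (4 * β) * bracket k₂ ^ (2 - M) := by
    rw [← Real.rpow_add hb2]; congr 1; ring
  calc (‖k₁‖ * ‖k₂‖ * ‖x‖ * ‖y‖) ^ (2 * β) * d * (bracket k₂ ^ (2 - M) * bracket y ^ (2 - M))
      ≤ (bracket k₁ ^ (4 * β) * bracket k₂ ^ (4 * β) * bracket y ^ (2 * β)) * d *
          (bracket k₂ ^ (2 - M) * bracket y ^ (2 - M)) := by gcongr
    _ = bracket k₁ ^ (4 * β) * (d * (bracket k₂ ^ (4 * β) * bracket k₂ ^ (2 - M)) *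
          (bracket y ^ (2 * β) * bracket y ^ (2 - M))) := by ring
    _ ≤ _ := by
        rw [h3]
        gcongr

lemma out₁_eq (k₁ k₂ : Wave) (σ : Sph) :
    out₁ k₁ k₂ σ = (1 / 2 : ℝ) • (k₁ + k₂) - ((-1) * (‖k₁ - k₂‖ / 2)) • (σ : Wave) := by
  rw [out₁, neg_one_mul, neg_smul, sub_neg_eq_add]

lemma out₂_eq (k₁ k₂ : Wave) (σ : Sph) :
    out₂ k₁ k₂ σ = (1 / 2 : ℝ) • (k₁ + k₂) - (1 * (‖k₁ - k₂‖ / 2)) • (σ : Wave) := by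
  rw [out₂, one_mul]

theorem exists_lintegral_kern_weight_le {β M : ℝ} (hβ : 0 ≤ β) (hβ' : β ≤ 1) (hM : 10 < M) :
    ∃ K : ℝ, 0 < K ∧ ∀ k₁ : Wave,
      ∫⁻ q, ENNReal.ofReal (kern β k₁ q * weight M k₁ q) ∂((volume : Measure Wave).prod surface) ≤
        ENNReal.ofReal (K * bracket k₁ ^ (4 * β - 1)) := by
  obtain ⟨K, hK, h⟩ := exists_lintegral_le_inv_bracket (p := M - 2 - 4 * β) (by linarith)
  refine ⟨2 * K, by positivity, fun k₁ => ?_⟩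
  have hb1 := bracket_pos k₁
  set F : ℝ → Wave × Sph → ℝ := fun ε q => ‖k₁ - q.1‖ * bracket q.1 ^ (-(M - 2 - 4 * β)) *
        ((1 + ‖(1 / 2 : ℝ) • (k₁ + q.1) - (ε * (‖k₁ - q.1‖ / 2)) • (q.2 : Wave)‖ ^ 2) ^ 2)⁻¹ with hF
  have hF0 : ∀ ε q, 0 ≤ F ε q := fun ε q => by
    have := bracket_pos q.1
    simp only [hF]
    positivity
  have hFm : ∀ ε, Measurable (F ε) := fun ε => by
    simp only [hF]
    fun_prop
  have h1 : ∀ q : Wave × Sph, ENNReal.ofReal (kern β k₁ q * weight M k₁ q) ≤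
      ENNReal.ofReal (bracket k₁ ^ (4 * β)) *
        (ENNReal.ofReal (F (-1) q) + ENNReal.ofReal (F 1 q)) := by
    intro q
    rw [← ENNReal.ofReal_add (hF0 _ _) (hF0 _ _), ← ENNReal.ofReal_mul (by positivity)]
    refine ENNReal.ofReal_le_ofReal ?_
    have he := energy k₁ q.1 q.2
    have e1 := kern_mul_rpow_le hβ hβ' hM k₁ q.1 (out₁ k₁ q.1 q.2) (out₂ k₁ q.1 q.2) ‖k₁ - q.1‖
      (norm_nonneg _) he
    have e2 := kern_mul_rpow_le hβ hβ' hM k₁ q.1 (out₂ k₁ q.1 q.2) (out₁ k₁ q.1 q.2) ‖k₁ - q.1‖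
      (norm_nonneg _) (by rw [add_comm]; exact he)
    rw [mul_right_comm _ ‖out₂ k₁ q.1 q.2‖] at e2
    simp only [hF, ← out₁_eq, ← out₂_eq]
    simp only [kern, weight]
    linarith
  refine (lintegral_mono h1).trans ?_
  rw [lintegral_const_mul' _ _ ENNReal.ofReal_ne_top,
    lintegral_add_left ((hFm _).ennreal_ofReal)]
  refine (mul_le_mul_right (add_le_add (h k₁ (-1) (by simp)) (h k₁ 1 (by simp))) _).trans ?_
  rw [← ENNReal.ofReal_add (by positivity) (by positivity), ← ENNReal.ofReal_mul (by positivity)]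
  refine ENNReal.ofReal_le_ofReal (le_of_eq ?_)
  rw [Real.rpow_sub_one hb1.ne']
  ring

instance : SFinite surface := by unfold surface; infer_instance

lemma bracket_le_two_mul {x y : ℝ} {k₁ k₂ z : Wave} (h : x ^ 2 + y ^ 2 = ‖k₁‖ ^ 2 + ‖k₂‖ ^ 2)
    (hx : x = ‖z‖) (hy : 0 ≤ y) (hyx : y ≤ x) :
    bracket k₁ ≤ 2 * bracket z ∧ bracket k₂ ≤ 2 * bracket z := by
  have hz := bracket_pos z
  have hyx2 : y ^ 2 ≤ x ^ 2 := by gcongr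
  subst hx
  constructor <;>
  · refine le_of_sq_le_sq ?_ (by positivity)
    rw [mul_pow, bracket_sq, bracket_sq]
    nlinarith [sq_nonneg ‖k₁‖, sq_nonneg ‖k₂‖]

lemma bracket_rpow_le {M : ℝ} (hM : 0 ≤ M) {k z : Wave} (h : bracket k ≤ 2 * bracket z) :
    bracket z ^ (-M) ≤ 2 ^ M * bracket k ^ (-M) := by
  have hz := bracket_pos z
  have hk := bracket_pos k
  calc bracket z ^ (-M) = 2 ^ M * (2 * bracket z) ^ (-M) := by
        rw [Real.mul_rpow (by norm_num) hz.le, ← mul_assoc, ← Real.rpow_add (by norm_num)]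
        simp
    _ ≤ 2 ^ M * bracket k ^ (-M) := by
        gcongr 2 ^ M * ?_
        exact Real.rpow_le_rpow_of_nonpos hk h (by linarith)

/-- The sum of the four cubic terms of the collision integrand, for the weight itself. -/
def cubic (M : ℝ) (k₁ : Wave) (q : Wave × Sph) : ℝ :=
  bracket q.1 ^ (-M) * bracket (out₁ k₁ q.1 q.2) ^ (-M) * bracket (out₂ k₁ q.1 q.2) ^ (-M) +
  bracket k₁ ^ (-M) * bracket (out₁ k₁ q.1 q.2) ^ (-M) * bracket (out₂ k₁ q.1 q.2) ^ (-M) +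
  bracket k₁ ^ (-M) * bracket q.1 ^ (-M) * bracket (out₂ k₁ q.1 q.2) ^ (-M) +
  bracket k₁ ^ (-M) * bracket q.1 ^ (-M) * bracket (out₁ k₁ q.1 q.2) ^ (-M)

lemma bracket_rpow_neg_le (M : ℝ) (k : Wave) : bracket k ^ (-M) ≤ bracket k ^ (2 - M) :=
  Real.rpow_le_rpow_of_exponent_le (one_le_bracket k) (by linarith)

lemma cubic_le {M : ℝ} (hM : 0 ≤ M) (k₁ : Wave) (q : Wave × Sph) :
    cubic M k₁ q ≤ (2 * 2 ^ M + 1) * (bracket k₁ ^ (-M) * weight M k₁ q) := by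
  have aux : ∀ w₁ w₂ w₃ w₄ D : ℝ, 0 ≤ w₁ → 0 ≤ w₂ → 0 ≤ w₃ → 0 ≤ w₄ → 0 ≤ D → w₃ ≤ D * w₁ →
      w₃ ≤ D * w₂ → w₂ * w₃ * w₄ + w₁ * w₃ * w₄ + w₁ * w₂ * w₄ + w₁ * w₂ * w₃ ≤
        (2 * D + 1) * (w₁ * (w₂ * (w₃ + w₄))) := by
    intro w₁ w₂ w₃ w₄ D h₁ h₂ h₃ h₄ hD h h'
    have e1 := mul_le_mul_of_nonneg_left h (mul_nonneg h₂ h₄)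
    have e2 := mul_le_mul_of_nonneg_left h' (mul_nonneg h₁ h₄)
    have e3 : 0 ≤ D * (w₁ * (w₂ * w₃)) := by positivity
    nlinarith
  have he := energy k₁ q.1 q.2
  have hp : ∀ k : Wave, 0 ≤ bracket k ^ (-M) := fun k => Real.rpow_nonneg (bracket_pos k).le _
  have main : cubic M k₁ q ≤ (2 * 2 ^ M + 1) * (bracket k₁ ^ (-M) * (bracket q.1 ^ (-M) *
      (bracket (out₁ k₁ q.1 q.2) ^ (-M) + bracket (out₂ k₁ q.1 q.2) ^ (-M)))) := by
    rcases le_total ‖out₂ k₁ q.1 q.2‖ ‖out₁ k₁ q.1 q.2‖ with h | h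
    · obtain ⟨h1, h2⟩ := bracket_le_two_mul he rfl (norm_nonneg _) h
      exact aux _ _ _ _ _ (hp _) (hp _) (hp _) (hp _) (by positivity) (bracket_rpow_le hM h1)
        (bracket_rpow_le hM h2)
    · rw [add_comm] at he
      obtain ⟨h1, h2⟩ := bracket_le_two_mul he rfl (norm_nonneg _) h
      refine le_trans (le_of_eq ?_) ((aux _ _ _ _ _ (hp k₁) (hp q.1) (hp (out₂ k₁ q.1 q.2))
        (hp (out₁ k₁ q.1 q.2)) (by positivity) (bracket_rpow_le hM h1)
        (bracket_rpow_le hM h2)).trans (le_of_eq ?_))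
      · unfold cubic; ring
      · ring
  refine main.trans ?_
  unfold weight
  have := bracket_pos q.1
  have := bracket_pos k₁
  have := bracket_pos (out₁ k₁ q.1 q.2)
  have := bracket_pos (out₂ k₁ q.1 q.2)
  gcongr ?_ * (?_ * (?_ * (?_ + ?_))) <;> exact bracket_rpow_neg_le M _

lemma abs_mul_mul_sub_le {a b c a' b' c' u v w G ε : ℝ}
    (hb : |b| ≤ G * v) (hc : |c| ≤ G * w) (ha' : |a'| ≤ G * u) (hb' : |b'| ≤ G * v)
    (h1 : |a - a'| ≤ ε * u) (h2 : |b - b'| ≤ ε * v) (h3 : |c - c'| ≤ ε * w) :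
    |a * b * c - a' * b' * c'| ≤ 3 * ε * G ^ 2 * (u * v * w) := by
  have e : a * b * c - a' * b' * c' =
      (a - a') * b * c + a' * (b - b') * c + a' * b' * (c - c') := by ring
  rw [e]
  have e1 : |(a - a') * b * c| ≤ (ε * u) * (G * v) * (G * w) := by
    rw [abs_mul, abs_mul]
    have := (abs_nonneg _).trans h1
    have := (abs_nonneg _).trans hb
    gcongr
  have e2 : |a' * (b - b') * c| ≤ (G * u) * (ε * v) * (G * w) := by
    rw [abs_mul, abs_mul]
    have := (abs_nonneg _).trans ha'
    have := (abs_nonneg _).trans h2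
    gcongr
  have e3 : |a' * b' * (c - c')| ≤ (G * u) * (G * v) * (ε * w) := by
    rw [abs_mul, abs_mul]
    have := (abs_nonneg _).trans ha'
    have := (abs_nonneg _).trans hb'
    gcongr
  refine (abs_add_three _ _ _).trans ?_
  linarith

/-- The collision integrand, without the kernel. -/
def bal (f : Wave → ℝ) (k₁ : Wave) (q : Wave × Sph) : ℝ :=
  gainLoss (f k₁) (f q.1) (f (out₁ k₁ q.1 q.2)) (f (out₂ k₁ q.1 q.2))

lemma collision_eq (β : ℝ) (f : Wave → ℝ) (k₁ : Wave) :
    collision β f k₁ =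
      (1 / 8) * ∫ q, kern β k₁ q * bal f k₁ q ∂((volume : Measure Wave).prod surface) := rfl

lemma abs_bal_sub_le {M G ε : ℝ} (hM : 0 ≤ M) (hε : 0 ≤ ε) {f g : Wave → ℝ} {k₁ : Wave}
    {q : Wave × Sph}
    (h : ∀ k ∈ ({k₁, q.1, out₁ k₁ q.1 q.2, out₂ k₁ q.1 q.2} : Set Wave),
      |f k| ≤ G * bracket k ^ (-M) ∧ |g k| ≤ G * bracket k ^ (-M) ∧
        |f k - g k| ≤ ε * bracket k ^ (-M)) :
    |bal f k₁ q - bal g k₁ q| ≤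
      3 * ε * G ^ 2 * (2 * 2 ^ M + 1) * (bracket k₁ ^ (-M) * weight M k₁ q) := by
  obtain ⟨a1, b1, c1⟩ := h k₁ (by simp)
  obtain ⟨a2, b2, c2⟩ := h q.1 (by simp)
  obtain ⟨a3, b3, c3⟩ := h (out₁ k₁ q.1 q.2) (by simp)
  obtain ⟨a4, b4, c4⟩ := h (out₂ k₁ q.1 q.2) (by simp)
  have e1 := abs_mul_mul_sub_le a3 a4 b2 b3 c2 c3 c4
  have e2 := abs_mul_mul_sub_le a3 a4 b1 b3 c1 c3 c4
  have e3 := abs_mul_mul_sub_le a2 a4 b1 b2 c1 c2 c4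
  have e4 := abs_mul_mul_sub_le a2 a3 b1 b2 c1 c2 c3
  have e5 := mul_le_mul_of_nonneg_left (cubic_le hM k₁ q) (show 0 ≤ 3 * ε * G ^ 2 by positivity)
  rw [← mul_assoc] at e5
  refine le_trans ?_ e5
  unfold bal gainLoss cubic
  rw [abs_le] at *
  constructor <;> linarith

lemma measurable_bal {f : Wave → ℝ} (hf : Measurable f) (k₁ : Wave) : Measurable (bal f k₁) := by
  have h1 : Measurable fun q : Wave × Sph => f (out₁ k₁ q.1 q.2) := by
    unfold out₁
    exact hf.comp (by fun_prop)
  have h2 : Measurable fun q : Wave × Sph => f (out₂ k₁ q.1 q.2) := by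
    unfold out₂
    exact hf.comp (by fun_prop)
  have h3 : Measurable fun q : Wave × Sph => f q.1 := hf.comp measurable_fst
  unfold bal gainLoss
  fun_prop

lemma measurable_kern_right (β : ℝ) (k₁ : Wave) : Measurable (kern β k₁) := by
  unfold kern out₁ out₂
  fun_prop

lemma measurable_weight_right (M : ℝ) (k₁ : Wave) : Measurable (weight M k₁) := by
  unfold weight out₁ out₂
  fun_prop

theorem exists_integral_kern_weight_le {β M : ℝ} (hβ : 0 ≤ β) (hβ' : β ≤ 1) (hM : 10 < M) :
    ∃ K : ℝ, 0 < K ∧ ∀ k₁ : Wave,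
      Integrable (fun q => kern β k₁ q * weight M k₁ q) ((volume : Measure Wave).prod surface) ∧
      ∫ q, kern β k₁ q * weight M k₁ q ∂((volume : Measure Wave).prod surface) ≤
        K * bracket k₁ ^ (4 * β - 1) := by
  obtain ⟨K, hK, h⟩ := exists_lintegral_kern_weight_le hβ hβ' hM
  refine ⟨K, hK, fun k₁ => ?_⟩
  have h0 : ∀ q, 0 ≤ kern β k₁ q * weight M k₁ q := fun q =>
    mul_nonneg (kern_nonneg _ _ _) (weight_nonneg _ _ _)
  have hm : AEStronglyMeasurable (fun q => kern β k₁ q * weight M k₁ q)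
      ((volume : Measure Wave).prod surface) :=
    ((measurable_kern_right β k₁).mul (measurable_weight_right M k₁)).aestronglyMeasurable
  have hb := bracket_pos k₁
  refine ⟨⟨hm, ?_⟩, ?_⟩
  · rw [hasFiniteIntegral_iff_ofReal (Eventually.of_forall h0)]
    exact (h k₁).trans_lt ENNReal.ofReal_lt_top
  · rw [integral_eq_lintegral_of_nonneg_ae (Eventually.of_forall h0) hm]
    exact ENNReal.toReal_le_of_le_ofReal (by positivity) (h k₁)

lemma integrable_kern_mul {β M D : ℝ} {k₁ : Wave} {F : Wave × Sph → ℝ}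
    (hint : Integrable (fun q => kern β k₁ q * weight M k₁ q) ((volume : Measure Wave).prod surface))
    (hF : Measurable F) (h : ∀ᵐ q ∂((volume : Measure Wave).prod surface),
      |F q| ≤ D * weight M k₁ q) :
    Integrable (fun q => kern β k₁ q * F q) ((volume : Measure Wave).prod surface) := by
  refine (hint.const_mul D).mono'
    ((measurable_kern_right β k₁).mul hF).aestronglyMeasurable ?_
  filter_upwards [h] with q hq
  rw [Real.norm_eq_abs, abs_mul, abs_of_nonneg (kern_nonneg _ _ _)]
  nlinarith [mul_le_mul_of_nonneg_left hq (kern_nonneg β k₁ q)]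

lemma ae_ae_translate {P : Wave → Prop} (hP : ∀ᵐ k : Wave, P k) {v : Wave × Sph → Wave}
    (hv : Measurable v) :
    ∀ᵐ k₁ : Wave, ∀ᵐ q ∂((volume : Measure Wave).prod surface), P (k₁ + v (q.1 - k₁, q.2)) := by
  obtain ⟨N, hN, hNm, hN0⟩ := exists_measurable_superset_of_null (mem_ae_iff.1 hP)
  have hmeas : MeasurableSet {p : (Wave × Sph) × Wave | p.2 + v p.1 ∈ Nᶜ} :=
    hNm.compl.preimage (by fun_prop)
  have h1 : ∀ᵐ q ∂((volume : Measure Wave).prod surface), ∀ᵐ k₁ : Wave, k₁ + v q ∈ Nᶜ := by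
    refine Eventually.of_forall fun q => ?_
    exact (measurePreserving_add_right volume (v q)).quasiMeasurePreserving.ae
      (p := fun k => k ∈ Nᶜ) (compl_mem_ae_iff.2 hN0)
  have h2 := (Measure.ae_ae_comm hmeas).1 h1
  filter_upwards [h2] with k₁ hk₁
  have hmp : MeasurePreserving (Prod.map (fun k : Wave => k - k₁) (id : Sph → Sph))
      ((volume : Measure Wave).prod surface) ((volume : Measure Wave).prod surface) :=
    (measurePreserving_sub_right volume k₁).prod (MeasurePreserving.id surface)
  filter_upwards [hmp.quasiMeasurePreserving.ae hk₁] with q hq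
  by_contra hc
  exact hq (hN hc)

lemma ae_ae_collision {P : Wave → Prop} (hP : ∀ᵐ k : Wave, P k) :
    ∀ᵐ k₁ : Wave, ∀ᵐ q ∂((volume : Measure Wave).prod surface),
      ∀ k ∈ ({k₁, q.1, out₁ k₁ q.1 q.2, out₂ k₁ q.1 q.2} : Set Wave), P k := by
  have h1 := ae_ae_translate hP (v := fun q => (1 / 2 : ℝ) • q.1 + (‖q.1‖ / 2) • (q.2 : Wave))
    (by fun_prop)
  have h2 := ae_ae_translate hP (v := fun q => (1 / 2 : ℝ) • q.1 - (‖q.1‖ / 2) • (q.2 : Wave))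
    (by fun_prop)
  filter_upwards [h1, h2, hP] with k₁ e1 e2 e3
  filter_upwards [e1, e2, Measure.quasiMeasurePreserving_fst.ae hP] with q f1 f2 f3
  have g1 : out₁ k₁ q.1 q.2 =
      k₁ + ((1 / 2 : ℝ) • (q.1 - k₁) + (‖q.1 - k₁‖ / 2) • (q.2 : Wave)) := by
    rw [out₁, norm_sub_rev]; module
  have g2 : out₂ k₁ q.1 q.2 =
      k₁ + ((1 / 2 : ℝ) • (q.1 - k₁) - (‖q.1 - k₁‖ / 2) • (q.2 : Wave)) := by
    rw [out₂, norm_sub_rev]; module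
  intro k hk
  simp only [Set.mem_insert_iff, Set.mem_singleton_iff] at hk
  rcases hk with rfl | rfl | rfl | rfl
  · exact e3
  · exact f3
  · rw [g1]; exact f1
  · rw [g2]; exact f2

/-- The collision operator is locally Lipschitz, with a loss of weight. -/
theorem exists_collision_sub_le {β M : ℝ} (hβ : 0 ≤ β) (hβ' : β ≤ 1) (hM : 10 < M) :
    ∃ K : ℝ, 0 < K ∧ ∀ (G ε : ℝ) (f g : Wave → ℝ), 0 ≤ G → 0 ≤ ε → Measurable f → Measurable g →
      (∀ᵐ k : Wave, |f k| ≤ G * bracket k ^ (-M) ∧ |g k| ≤ G * bracket k ^ (-M) ∧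
        |f k - g k| ≤ ε * bracket k ^ (-M)) →
      ∀ᵐ k : Wave, |collision β f k - collision β g k| ≤
        ε * G ^ 2 * K * bracket k ^ (4 * β - 1 - M) := by
  obtain ⟨K, hK, hKint⟩ := exists_integral_kern_weight_le hβ hβ' hM
  have hM0 : 0 ≤ M := by linarith
  refine ⟨3 * (2 * 2 ^ M + 1) * K, by positivity, fun G ε f g hG hε hf hg h => ?_⟩
  filter_upwards [ae_ae_collision h] with k₁ hk₁
  obtain ⟨hint, hle⟩ := hKint k₁
  have hb := bracket_pos k₁
  have hif : Integrable (fun q => kern β k₁ q * bal f k₁ q)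
      ((volume : Measure Wave).prod surface) := by
    refine integrable_kern_mul (D := 3 * G * G ^ 2 * (2 * 2 ^ M + 1) * bracket k₁ ^ (-M)) hint
      (measurable_bal hf k₁) ?_
    filter_upwards [hk₁] with q hq
    have := abs_bal_sub_le (f := f) (g := 0) hM0 hG (fun k hk => ⟨(hq k hk).1, by
      have := bracket_pos k
      simp only [Pi.zero_apply, abs_zero]; positivity, by simpa using (hq k hk).1⟩)
    simpa [bal, gainLoss, mul_assoc] using this
  have hig : Integrable (fun q => kern β k₁ q * bal g k₁ q)
      ((volume : Measure Wave).prod surface) := by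
    refine integrable_kern_mul (D := 3 * G * G ^ 2 * (2 * 2 ^ M + 1) * bracket k₁ ^ (-M)) hint
      (measurable_bal hg k₁) ?_
    filter_upwards [hk₁] with q hq
    have := abs_bal_sub_le (f := g) (g := 0) hM0 hG (fun k hk => ⟨(hq k hk).2.1, by
      have := bracket_pos k
      simp only [Pi.zero_apply, abs_zero]; positivity, by simpa using (hq k hk).2.1⟩)
    simpa [bal, gainLoss, mul_assoc] using this
  rw [collision_eq, collision_eq, ← mul_sub, ← integral_sub hif hig, abs_mul]
  have h1 : |∫ q, kern β k₁ q * bal f k₁ q - kern β k₁ q * bal g k₁ q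
        ∂((volume : Measure Wave).prod surface)| ≤
      ∫ q, (3 * ε * G ^ 2 * (2 * 2 ^ M + 1) * bracket k₁ ^ (-M)) * (kern β k₁ q * weight M k₁ q)
        ∂((volume : Measure Wave).prod surface) := by
    rw [← Real.norm_eq_abs]
    refine norm_integral_le_of_norm_le (hint.const_mul _) ?_
    filter_upwards [hk₁] with q hq
    have := mul_le_mul_of_nonneg_left (abs_bal_sub_le hM0 hε hq) (kern_nonneg β k₁ q)
    rw [← mul_sub, Real.norm_eq_abs, abs_mul, abs_of_nonneg (kern_nonneg _ _ _)]
    linarith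
  rw [integral_const_mul] at h1
  have h2 : bracket k₁ ^ (4 * β - 1 - M) = bracket k₁ ^ (-M) * bracket k₁ ^ (4 * β - 1) := by
    rw [← Real.rpow_add hb]; congr 1; ring
  rw [h2, abs_of_pos (by norm_num)]
  have h3 := mul_le_mul_of_nonneg_left hle
    (show 0 ≤ 3 * ε * G ^ 2 * (2 * 2 ^ M + 1) * bracket k₁ ^ (-M) by positivity)
  have h4 := (abs_nonneg _).trans h1
  linarith

lemma le_integral_one_sub_cos {a b S N : ℝ} (hb : 0 < b) (hN : 4 ≤ N) :
    1 / (2 * b) ≤ ∫ s in ((a - 2) / b)..((a - 1) / b), (1 - Real.cos (N * (S - (a - b * s)))) := by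
  have hN0 : 0 < N := by linarith
  have hder : ∀ s ∈ Set.uIcc ((a - 2) / b) ((a - 1) / b),
      HasDerivAt (fun s => s - Real.sin (N * (S - (a - b * s))) / (N * b))
        (1 - Real.cos (N * (S - (a - b * s)))) s := by
    intro s _
    have h1 : HasDerivAt (fun s => N * (S - (a - b * s))) (N * b) s := by
      simpa using ((((hasDerivAt_id s).const_mul b).const_sub a).const_sub S).const_mul N
    refine ((hasDerivAt_id' s).fun_sub (h1.sin.div_const (N * b))).congr_deriv ?_
    field_simp
  rw [intervalIntegral.integral_eq_sub_of_hasDerivAt hder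
    (Continuous.intervalIntegrable (by fun_prop) _ _)]
  set x := Real.sin (N * (S - (a - b * ((a - 1) / b))))
  set y := Real.sin (N * (S - (a - b * ((a - 2) / b))))
  have hx : x ≤ 1 := Real.sin_le_one _
  have hy : -1 ≤ y := Real.neg_one_le_sin _
  have e : (a - 1) / b - x / (N * b) - ((a - 2) / b - y / (N * b)) = (1 - (x - y) / N) / b := by
    field_simp
    ring
  rw [e, show 1 / (2 * b) = (1 / 2) / b by ring]
  gcongr
  have : (x - y) / N ≤ 2 / 4 := by gcongr; linarith
  linarith

/-- The set where `k₂` and the second outgoing wave vector are of order one. -/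
def resSet (k₁ : Wave) : Set (Wave × Sph) :=
  {q | (1 / 2 ≤ ‖q.1‖ ∧ ‖q.1‖ ≤ 1) ∧ 1 ≤ ‖out₂ k₁ q.1 q.2‖ ^ 2 ∧ ‖out₂ k₁ q.1 q.2‖ ^ 2 ≤ 2}

lemma measurableSet_resSet (k₁ : Wave) : MeasurableSet (resSet k₁) := by
  have h1 : Measurable fun q : Wave × Sph => ‖q.1‖ := by fun_prop
  have h2 : Measurable fun q : Wave × Sph => ‖out₂ k₁ q.1 q.2‖ ^ 2 := by
    unfold out₂
    fun_prop
  exact ((measurableSet_Icc (a := (1 / 2 : ℝ)) (b := 1)).preimage h1).inter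
    ((measurableSet_Icc (a := (1 : ℝ)) (b := 2)).preimage h2)

/-- The oscillating part of the collision integrand. -/
def osc (N : ℝ) (k₁ : Wave) : Wave × Sph → ℝ :=
  (resSet k₁).indicator fun q => 1 - Real.cos (N * ‖out₁ k₁ q.1 q.2‖ ^ 2)

lemma osc_nonneg (N : ℝ) (k₁ : Wave) (q : Wave × Sph) : 0 ≤ osc N k₁ q :=
  Set.indicator_nonneg (fun _ _ => sub_nonneg.2 (Real.cos_le_one _)) _

lemma measurable_osc (N : ℝ) (k₁ : Wave) : Measurable (osc N k₁) := by
  refine Measurable.indicator ?_ (measurableSet_resSet k₁)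
  unfold out₁
  fun_prop

lemma le_lintegral_surface_osc {N : ℝ} (hN : 4 ≤ N) {k₁ k₂ : Wave} (hk₁ : 2 ≤ ‖k₁‖)
    (hk₂ : 1 / 2 ≤ ‖k₂‖ ∧ ‖k₂‖ ≤ 1) :
    ENNReal.ofReal (2 * Real.pi / (‖k₁ - k₂‖ * ‖k₁ + k₂‖)) ≤
      ∫⁻ σ : Sph, ENNReal.ofReal (osc N k₁ (k₂, σ)) ∂surface := by
  obtain ⟨e, he, hc⟩ := exists_unit_smul ((1 / 2 : ℝ) • (k₁ + k₂))
  have hcn : ‖(1 / 2 : ℝ) • (k₁ + k₂)‖ = ‖k₁ + k₂‖ / 2 := by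
    rw [norm_smul]; norm_num; ring
  set u := ‖k₁ - k₂‖ with hu
  set v := ‖k₁ + k₂‖ with hv
  set a := (v / 2) ^ 2 + (u / 2) ^ 2 with ha
  set b := u * v / 2 with hb
  have h1 : ‖k₁‖ ≤ u + ‖k₂‖ := by
    have := norm_add_le (k₁ - k₂) k₂
    rwa [sub_add_cancel] at this
  have h2 : ‖k₁‖ ≤ v + ‖k₂‖ := by
    have := norm_sub_le (k₁ + k₂) k₂
    rwa [add_sub_cancel_right] at this
  have h3 : u ≤ v + 2 * ‖k₂‖ := by
    have := norm_sub_le (k₁ + k₂) ((2 : ℝ) • k₂)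
    rw [norm_smul, show k₁ + k₂ - (2 : ℝ) • k₂ = k₁ - k₂ by module] at this
    simpa using this
  have h4 : v ≤ u + 2 * ‖k₂‖ := by
    have := norm_add_le (k₁ - k₂) ((2 : ℝ) • k₂)
    rw [norm_smul, show k₁ - k₂ + (2 : ℝ) • k₂ = k₁ + k₂ by module] at this
    simpa using this
  have h5 : 2 * ‖k₁‖ ≤ u + v := by
    have := norm_add_le (k₁ - k₂) (k₁ + k₂)
    rw [show k₁ - k₂ + (k₁ + k₂) = (2 : ℝ) • k₁ by module, norm_smul] at this
    simpa using this
  have hu0 : 0 < u := by linarith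
  have hv0 : 0 < v := by linarith
  have hb0 : 0 < b := by positivity
  have hout₂ : ∀ σ : Sph, ‖out₂ k₁ k₂ σ‖ ^ 2 = a - b * inner ℝ e (σ : Wave) := by
    intro σ
    rw [out₂, norm_sub_smul_sq _ e hc, hcn, ha, hb]
    ring
  have hout₁ : ∀ σ : Sph, ‖out₁ k₁ k₂ σ‖ ^ 2 = 2 * a - (a - b * inner ℝ e (σ : Wave)) := by
    intro σ
    have := energy k₁ k₂ σ
    have h6 := parallelogram_law_with_norm ℝ k₁ k₂
    rw [hout₂] at this
    rw [ha] at *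
    nlinarith
  set φ : ℝ → ENNReal := {s : ℝ | 1 ≤ a - b * s ∧ a - b * s ≤ 2}.indicator
    fun s => ENNReal.ofReal (1 - Real.cos (N * (2 * a - (a - b * s)))) with hφ
  have hset : MeasurableSet {s : ℝ | 1 ≤ a - b * s ∧ a - b * s ≤ 2} :=
    (measurableSet_Icc (a := (1 : ℝ)) (b := 2)).preimage
      (by fun_prop : Measurable fun s : ℝ => a - b * s)
  have hφm : Measurable φ := Measurable.indicator (by fun_prop) hset
  have h6 : ∀ σ : Sph, ENNReal.ofReal (osc N k₁ (k₂, σ)) = φ (inner ℝ e (σ : Wave)) := by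
    intro σ
    by_cases hσ : 1 ≤ a - b * inner ℝ e (σ : Wave) ∧ a - b * inner ℝ e (σ : Wave) ≤ 2
    · have hr : (k₂, σ) ∈ resSet k₁ := ⟨hk₂, by rw [hout₂]; exact hσ⟩
      rw [osc, hφ, Set.indicator_of_mem hr, Set.indicator_of_mem (Set.mem_ofPred_eq ▸ hσ), hout₁]
    · have hr : (k₂, σ) ∉ resSet k₁ := fun h => hσ (by rw [← hout₂]; exact h.2)
      rw [osc, hφ, Set.indicator_of_notMem hr,
        Set.indicator_of_notMem (Set.mem_ofPred_eq ▸ hσ), ENNReal.ofReal_zero]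
  rw [lintegral_congr h6, lintegral_surface_inner e he φ hφm]
  have hIcc : {s : ℝ | 1 ≤ a - b * s ∧ a - b * s ≤ 2} = Set.Icc ((a - 2) / b) ((a - 1) / b) := by
    ext s
    simp only [Set.mem_ofPred_eq, Set.mem_Icc, div_le_iff₀ hb0, le_div_iff₀ hb0]
    constructor <;> rintro ⟨_, _⟩ <;> constructor <;> linarith
  have hsub : Set.Icc ((a - 2) / b) ((a - 1) / b) ⊆ Set.Icc (-1 : ℝ) 1 := by
    refine Set.Icc_subset_Icc ?_ ?_
    · rw [le_div_iff₀ hb0]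
      nlinarith
    · rw [div_le_iff₀ hb0]
      have : (v - u) ^ 2 ≤ 2 ^ 2 := sq_le_sq' (by linarith [hk₂.2]) (by linarith [hk₂.2])
      nlinarith
  have h7 : ∫⁻ s in Set.Icc (-1 : ℝ) 1, φ s =
      ENNReal.ofReal (∫ s in ((a - 2) / b)..((a - 1) / b),
        (1 - Real.cos (N * (2 * a - (a - b * s))))) := by
    rw [hφ, hIcc, setLIntegral_indicator measurableSet_Icc, Set.inter_eq_left.2 hsub,
      intervalIntegral.integral_of_le (by gcongr; norm_num), ← integral_Icc_eq_integral_Ioc,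
      ofReal_integral_eq_lintegral_ofReal]
    · exact Continuous.integrableOn_Icc (by fun_prop)
    · exact Eventually.of_forall fun s => sub_nonneg.2 (Real.cos_le_one _)
  rw [h7, ← ENNReal.ofReal_mul (by positivity)]
  refine ENNReal.ofReal_le_ofReal ?_
  calc 2 * Real.pi / (u * v) = 2 * Real.pi * (1 / (2 * b)) := by rw [hb]; field_simp
    _ ≤ _ := by
      gcongr
      exact le_integral_one_sub_cos hb0 hN

lemma le_kern_of_mem_resSet {β : ℝ} (hβ : 0 ≤ β) (hβ' : β ≤ 1) {k₁ : Wave} (hk₁ : 2 ≤ ‖k₁‖)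
    {q : Wave × Sph} (hq : q ∈ resSet k₁) :
    ‖k₁‖ ^ (4 * β) / 16 * ‖k₁ - q.1‖ ≤ kern β k₁ q := by
  obtain ⟨⟨h1, h2⟩, h3, h4⟩ := hq
  have he := energy k₁ q.1 q.2
  have h5 : ‖k₁‖ / 2 ≤ ‖out₁ k₁ q.1 q.2‖ := by
    refine le_of_sq_le_sq ?_ (norm_nonneg _)
    nlinarith
  have h6 : 1 ≤ ‖out₂ k₁ q.1 q.2‖ := by
    refine le_of_sq_le_sq ?_ (norm_nonneg _)
    linarith
  unfold kern
  refine mul_le_mul_of_nonneg_right ?_ (norm_nonneg _)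
  calc ‖k₁‖ ^ (4 * β) / 16 ≤ ‖k₁‖ ^ (4 * β) / 4 ^ (2 * β) := by
        gcongr
        calc (4 : ℝ) ^ (2 * β) ≤ 4 ^ (2 : ℝ) :=
              Real.rpow_le_rpow_of_exponent_le (by norm_num) (by linarith)
          _ = 16 := by norm_num
    _ = (‖k₁‖ * (1 / 2) * (‖k₁‖ / 2) * 1) ^ (2 * β) := by
        rw [show ‖k₁‖ * (1 / 2) * (‖k₁‖ / 2) * 1 = ‖k₁‖ ^ (2 : ℝ) / 4 by
          rw [Real.rpow_two]; ring, Real.div_rpow (by positivity) (by norm_num),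
          ← Real.rpow_mul (by positivity)]
        ring_nf
    _ ≤ _ := by gcongr

lemma exists_le_lintegral_kern_osc {β : ℝ} (hβ : 0 ≤ β) (hβ' : β ≤ 1) :
    ∃ c : ℝ, 0 < c ∧ ∀ (N : ℝ) (k₁ : Wave), 4 ≤ N → 2 ≤ ‖k₁‖ →
      ENNReal.ofReal (c * ‖k₁‖ ^ (4 * β - 1)) ≤
        ∫⁻ q, ENNReal.ofReal (kern β k₁ q * osc N k₁ q)
          ∂((volume : Measure Wave).prod surface) := by
  set Q : Set Wave := {k | 1 / 2 ≤ ‖k‖ ∧ ‖k‖ ≤ 1} with hQ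
  have hQm : MeasurableSet Q :=
    (measurableSet_Icc (a := (1 / 2 : ℝ)) (b := 1)).preimage
      (by fun_prop : Measurable fun k : Wave => ‖k‖)
  have hQfin : volume Q ≠ ⊤ := by
    have : Q ⊆ Metric.closedBall 0 1 := fun k hk => by simpa using hk.2
    exact ((measure_mono this).trans_lt measure_closedBall_lt_top).ne
  have hQpos : volume Q ≠ 0 := by
    obtain ⟨x, hx⟩ := exists_norm_eq Wave (show (0 : ℝ) ≤ 3 / 4 by norm_num)
    have : Metric.ball x (1 / 4) ⊆ Q := by
      intro y hy
      rw [mem_ball_iff_norm] at hy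
      have h1 := norm_sub_norm_le x y
      have h2 := norm_sub_norm_le y x
      rw [norm_sub_rev] at h1
      constructor <;> linarith
    exact ((Metric.measure_ball_pos volume x (by norm_num)).trans_le (measure_mono this)).ne'
  refine ⟨Real.pi / 16 * (volume Q).toReal,
    mul_pos (by positivity) (ENNReal.toReal_pos hQpos hQfin), fun N k₁ hN hk₁ => ?_⟩
  have hk0 : 0 < ‖k₁‖ := by linarith
  have hm : Measurable fun q : Wave × Sph => ENNReal.ofReal (kern β k₁ q * osc N k₁ q) :=
    ((measurable_kern_right β k₁).mul (measurable_osc N k₁)).ennreal_ofReal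
  rw [lintegral_prod _ hm.aemeasurable]
  have h1 : ∀ k₂ : Wave, Q.indicator (fun _ => ENNReal.ofReal (Real.pi / 16 * ‖k₁‖ ^ (4 * β - 1))) k₂ ≤
      ∫⁻ σ : Sph, ENNReal.ofReal (kern β k₁ (k₂, σ) * osc N k₁ (k₂, σ)) ∂surface := by
    intro k₂
    by_cases hk₂ : k₂ ∈ Q
    · rw [Set.indicator_of_mem hk₂]
      have hu0 : 0 < ‖k₁ - k₂‖ := by
        have := norm_sub_norm_le k₁ k₂
        linarith [hk₂.2]
      have hv0 : 0 < ‖k₁ + k₂‖ := by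
        have := norm_sub_norm_le k₁ (-k₂)
        rw [norm_neg, sub_neg_eq_add] at this
        linarith [hk₂.2]
      have hv : ‖k₁ + k₂‖ ≤ 2 * ‖k₁‖ := by
        have := norm_add_le k₁ k₂
        linarith [hk₂.2]
      calc ENNReal.ofReal (Real.pi / 16 * ‖k₁‖ ^ (4 * β - 1))
          ≤ ENNReal.ofReal (‖k₁‖ ^ (4 * β) / 16 * ‖k₁ - k₂‖) *
              ENNReal.ofReal (2 * Real.pi / (‖k₁ - k₂‖ * ‖k₁ + k₂‖)) := by
            rw [← ENNReal.ofReal_mul (by positivity)]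
            refine ENNReal.ofReal_le_ofReal ?_
            calc Real.pi / 16 * ‖k₁‖ ^ (4 * β - 1)
                = ‖k₁‖ ^ (4 * β) / 16 * (2 * Real.pi / (2 * ‖k₁‖)) := by
                  rw [Real.rpow_sub_one hk0.ne']; field_simp
              _ ≤ ‖k₁‖ ^ (4 * β) / 16 * (2 * Real.pi / ‖k₁ + k₂‖) := by gcongr
              _ = _ := by field_simp
        _ ≤ ENNReal.ofReal (‖k₁‖ ^ (4 * β) / 16 * ‖k₁ - k₂‖) *
              ∫⁻ σ : Sph, ENNReal.ofReal (osc N k₁ (k₂, σ)) ∂surface := by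
            gcongr
            exact le_lintegral_surface_osc hN hk₁ hk₂
        _ = ∫⁻ σ : Sph, ENNReal.ofReal (‖k₁‖ ^ (4 * β) / 16 * ‖k₁ - k₂‖) *
              ENNReal.ofReal (osc N k₁ (k₂, σ)) ∂surface :=
            (lintegral_const_mul' _ _ ENNReal.ofReal_ne_top).symm
        _ ≤ _ := by
            refine lintegral_mono fun σ => ?_
            rw [← ENNReal.ofReal_mul (by positivity)]
            refine ENNReal.ofReal_le_ofReal ?_
            by_cases hq : (k₂, σ) ∈ resSet k₁
            · have h := le_kern_of_mem_resSet hβ hβ' hk₁ hq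
              dsimp only at h
              have h0 := osc_nonneg N k₁ (k₂, σ)
              gcongr
            · simp [osc, hq]
    · rw [Set.indicator_of_notMem hk₂]
      exact zero_le
  refine le_trans (le_of_eq ?_) (lintegral_mono h1)
  rw [lintegral_indicator hQm, setLIntegral_const, mul_right_comm,
    ENNReal.ofReal_mul (by positivity), ENNReal.ofReal_toReal hQfin]

lemma integrable_kern_osc {β M N : ℝ} (hM : 2 ≤ M) {k₁ : Wave}
    (hint : Integrable (fun q => kern β k₁ q * weight M k₁ q)
      ((volume : Measure Wave).prod surface)) :
    Integrable (fun q => kern β k₁ q * osc N k₁ q) ((volume : Measure Wave).prod surface) := by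
  refine integrable_kern_mul (D := 2 * (2 ^ (2 - M) * 2 ^ (2 - M))⁻¹) hint
    (measurable_osc N k₁) (Eventually.of_forall fun q => ?_)
  rw [abs_of_nonneg (osc_nonneg _ _ _)]
  have hw := weight_nonneg M k₁ q
  by_cases hq : q ∈ resSet k₁
  · have h1 : osc N k₁ q ≤ 2 := by
      rw [osc, Set.indicator_of_mem hq]
      linarith [Real.neg_one_le_cos (N * ‖out₁ k₁ q.1 q.2‖ ^ 2)]
    obtain ⟨⟨-, h2⟩, -, h3⟩ := hq
    have h4 : ∀ k : Wave, ‖k‖ ^ 2 ≤ 2 → (2 : ℝ) ^ (2 - M) ≤ bracket k ^ (2 - M) := by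
      intro k hk
      refine Real.rpow_le_rpow_of_nonpos (bracket_pos k) ?_ (by linarith)
      refine le_of_sq_le_sq ?_ (by norm_num)
      rw [bracket_sq]
      linarith
    have h5 : (2 : ℝ) ^ (2 - M) * 2 ^ (2 - M) ≤ weight M k₁ q := by
      have := bracket_pos (out₁ k₁ q.1 q.2)
      have := bracket_pos q.1
      unfold weight
      refine mul_le_mul (h4 _ ?_) ?_ (by positivity) (by positivity)
      · nlinarith [norm_nonneg q.1]
      · exact (h4 _ h3).trans (le_add_of_nonneg_left (by positivity))
    refine h1.trans ?_
    rw [mul_assoc]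
    refine le_mul_of_one_le_right (by norm_num) ?_
    rw [inv_mul_eq_div]
    exact (one_le_div (by positivity)).2 h5
  · rw [osc, Set.indicator_of_notMem hq]
    positivity

/-- The envelope of the oscillating datum. -/
def profile (M : ℝ) (k : Wave) : ℝ := (1 + (‖k‖ ^ 2) ^ 2) ^ (-(M / 4))

lemma profile_pos (M : ℝ) (k : Wave) : 0 < profile M k := by
  unfold profile
  positivity

lemma datum_eq (M A : ℝ) (N : ℕ) (k : Wave) :
    datum M A N k = (A + Real.cos (N * ‖k‖ ^ 2)) * profile M k := by
  rw [datum, profile, Real.rpow_neg (by positivity), div_eq_mul_inv, ← pow_mul]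

lemma bracket_rpow_eq (M : ℝ) (k : Wave) :
    bracket k ^ (-M) = ((1 + ‖k‖ ^ 2) ^ 2) ^ (-(M / 4)) := by
  rw [← bracket_sq, ← pow_mul, ← Real.rpow_natCast, ← Real.rpow_mul (bracket_pos k).le]
  congr 1
  push_cast
  ring

lemma bracket_rpow_le_profile {M : ℝ} (hM : 0 ≤ M) (k : Wave) :
    bracket k ^ (-M) ≤ profile M k := by
  rw [bracket_rpow_eq, profile]
  refine Real.rpow_le_rpow_of_nonpos (by positivity) ?_ (by linarith)
  nlinarith [sq_nonneg ‖k‖]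

lemma profile_le {M : ℝ} (hM : 0 ≤ M) (k : Wave) :
    profile M k ≤ 2 ^ (M / 4) * bracket k ^ (-M) := by
  have h : (2 : ℝ) ^ (M / 4) * ((1 + ‖k‖ ^ 2) ^ 2) ^ (-(M / 4)) =
      ((1 + ‖k‖ ^ 2) ^ 2 / 2) ^ (-(M / 4)) := by
    rw [Real.div_rpow (by positivity) (by norm_num), Real.rpow_neg (x := 2) (by norm_num)]
    field_simp
  rw [bracket_rpow_eq, h, profile]
  refine Real.rpow_le_rpow_of_nonpos (by positivity) ?_ (by linarith)
  nlinarith [sq_nonneg (‖k‖ ^ 2 - 1)]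

lemma abs_rpow_sub_le {m x y : ℝ} (hm : 0 ≤ m) (hx : 0 < x) (hy : x / 2 ≤ y) :
    |(1 + y ^ 2) ^ (-m) - (1 + x ^ 2) ^ (-m)| ≤
      4 * m * 4 ^ m * ((1 + x ^ 2) ^ (-m) * |y - x| / x) := by
  have hder : ∀ z ∈ Set.Ici (x / 2), HasDerivWithinAt (fun z : ℝ => (1 + z ^ 2) ^ (-m))
      ((2 * z) * (-m) * (1 + z ^ 2) ^ (-m - 1)) (Set.Ici (x / 2)) z := by
    intro z _
    have h1 : HasDerivAt (fun z : ℝ => 1 + z ^ 2) (2 * z) z := by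
      simpa using (hasDerivAt_pow 2 z).const_add 1
    exact (h1.rpow_const (Or.inl (by positivity))).hasDerivWithinAt
  have hbound : ∀ z ∈ Set.Ici (x / 2), ‖(2 * z) * (-m) * (1 + z ^ 2) ^ (-m - 1)‖ ≤
      4 * m * 4 ^ m * ((1 + x ^ 2) ^ (-m) / x) := by
    intro z hz
    have hz' : x / 2 ≤ z := hz
    have hz0 : 0 < z := by linarith
    have e1 : (1 + z ^ 2) ^ (-m) ≤ 4 ^ m * (1 + x ^ 2) ^ (-m) := by
      calc (1 + z ^ 2) ^ (-m) ≤ ((1 + x ^ 2) / 4) ^ (-m) := by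
            refine Real.rpow_le_rpow_of_nonpos (by positivity) ?_ (by linarith)
            nlinarith
        _ = _ := by
            rw [Real.div_rpow (by positivity) (by norm_num), Real.rpow_neg (x := 4) (by norm_num)]
            field_simp
    have e2 : z / (1 + z ^ 2) ≤ 2 / x := by
      rw [div_le_div_iff₀ (by positivity) hx]
      nlinarith
    rw [Real.norm_eq_abs, abs_mul, abs_mul, abs_neg, abs_of_nonneg hm, abs_of_pos (by positivity),
      abs_of_pos (by positivity), Real.rpow_sub_one (by positivity)]
    calc 2 * z * m * ((1 + z ^ 2) ^ (-m) / (1 + z ^ 2))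
        = 2 * m * ((z / (1 + z ^ 2)) * (1 + z ^ 2) ^ (-m)) := by ring
      _ ≤ 2 * m * ((2 / x) * (4 ^ m * (1 + x ^ 2) ^ (-m))) := by gcongr
      _ = _ := by ring
  have := (convex_Ici (x / 2)).norm_image_sub_le_of_norm_hasDerivWithin_le hder hbound
    (show x / 2 ≤ x by linarith) hy
  rw [Real.norm_eq_abs, Real.norm_eq_abs] at this
  refine this.trans (le_of_eq ?_)
  ring

lemma abs_profile_sub_le {M : ℝ} (hM : 0 ≤ M) {k x : Wave} {d : ℝ} (hk : 1 ≤ ‖k‖)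
    (hx : ‖k‖ ^ 2 / 2 ≤ ‖x‖ ^ 2) (hd : |‖x‖ ^ 2 - ‖k‖ ^ 2| ≤ d) :
    |profile M x - profile M k| ≤
      2 * M * 4 ^ (M / 4) * (profile M k * d / bracket k ^ 2) := by
  have hk2 : 0 < ‖k‖ ^ 2 := by positivity
  refine (abs_rpow_sub_le (by linarith) hk2 hx).trans ?_
  have h1 : bracket k ^ 2 / 2 ≤ ‖k‖ ^ 2 := by
    rw [bracket_sq]
    nlinarith
  have hb := bracket_pos k
  have hp := profile_pos M k
  have hd0 := (abs_nonneg _).trans hd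
  calc 4 * (M / 4) * 4 ^ (M / 4) * (profile M k * |‖x‖ ^ 2 - ‖k‖ ^ 2| / ‖k‖ ^ 2)
      ≤ 4 * (M / 4) * 4 ^ (M / 4) * (profile M k * d / (bracket k ^ 2 / 2)) := by gcongr
    _ = _ := by field_simp

lemma datum_le {M A : ℝ} (hA : 1 ≤ A) (N : ℕ) (k : Wave) :
    datum M A N k ≤ 2 * A * profile M k := by
  rw [datum_eq]
  have := Real.cos_le_one (N * ‖k‖ ^ 2)
  have := profile_pos M k
  gcongr
  linarith

lemma le_datum {M A : ℝ} (hA : 2 ≤ A) (N : ℕ) (k : Wave) :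
    A / 2 * profile M k ≤ datum M A N k := by
  rw [datum_eq]
  have := Real.neg_one_le_cos (N * ‖k‖ ^ 2)
  have := profile_pos M k
  gcongr
  linarith

lemma datum_pos {M A : ℝ} (hA : 2 ≤ A) (N : ℕ) (k : Wave) : 0 < datum M A N k :=
  (mul_pos (by linarith) (profile_pos M k)).trans_le (le_datum hA N k)

lemma measurable_datum (M A : ℝ) (N : ℕ) : Measurable (datum M A N) := by
  unfold datum
  fun_prop

lemma profile_mul_le {M : ℝ} (hM : 0 ≤ M) (k₂ y : Wave) :
    profile M k₂ * profile M y * (‖k₂‖ ^ 2 + ‖y‖ ^ 2) ≤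
      (2 ^ (M / 4)) ^ 2 * (bracket k₂ ^ (2 - M) * bracket y ^ (2 - M)) := by
  have hb2 := bracket_pos k₂
  have hby := bracket_pos y
  have hp2 := profile_pos M k₂
  have hpy := profile_pos M y
  have h1 : ‖k₂‖ ^ 2 + ‖y‖ ^ 2 ≤ bracket k₂ ^ 2 * bracket y ^ 2 := by
    rw [bracket_sq, bracket_sq]
    nlinarith [mul_nonneg (sq_nonneg ‖k₂‖) (sq_nonneg ‖y‖)]
  have h2 : ∀ k : Wave, bracket k ^ (2 - M) = bracket k ^ (-M) * bracket k ^ 2 := by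
    intro k
    rw [← Real.rpow_two, ← Real.rpow_add (bracket_pos k)]
    congr 1; ring
  calc profile M k₂ * profile M y * (‖k₂‖ ^ 2 + ‖y‖ ^ 2)
      ≤ (2 ^ (M / 4) * bracket k₂ ^ (-M)) * (2 ^ (M / 4) * bracket y ^ (-M)) *
          (bracket k₂ ^ 2 * bracket y ^ 2) := by
        gcongr
        · exact profile_le hM k₂
        · exact profile_le hM y
    _ = _ := by rw [h2, h2]; ring

lemma profile_mul_le' {M : ℝ} (hM : 0 ≤ M) (k₂ y : Wave) :
    profile M k₂ * profile M y ≤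
      (2 ^ (M / 4)) ^ 2 * (bracket k₂ ^ (2 - M) * bracket y ^ (2 - M)) := by
  have hb2 := bracket_pos k₂
  have hby := bracket_pos y
  have hp2 := profile_pos M k₂
  calc profile M k₂ * profile M y
      ≤ (2 ^ (M / 4) * bracket k₂ ^ (2 - M)) * (2 ^ (M / 4) * bracket y ^ (2 - M)) := by
        have h : ∀ k : Wave, profile M k ≤ 2 ^ (M / 4) * bracket k ^ (2 - M) := fun k =>
          (profile_le hM k).trans (mul_le_mul_of_nonneg_left (bracket_rpow_neg_le M k)
            (by positivity))
        exact mul_le_mul (h _) (h _) (profile_pos M y).le (by positivity)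
    _ = _ := by ring

lemma profile_out_mul_le {M : ℝ} (hM : 2 ≤ M) {k₁ k₂ x y : Wave} (h₁ : bracket k₁ ≤ 2 * bracket x)
    (h₂ : bracket k₂ ≤ 2 * bracket x) :
    profile M x * profile M y ≤ (2 ^ (M / 4)) ^ 2 * 2 ^ M *
      (bracket k₂ ^ (2 - M) * bracket y ^ (2 - M)) / bracket k₁ ^ 2 := by
  have hb1 := bracket_pos k₁
  have hb2 := bracket_pos k₂
  have hbx := bracket_pos x
  have hby := bracket_pos y
  have e1 := bracket_rpow_le (M := 2) (by norm_num) h₁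
  have e2 := bracket_rpow_le (M := M - 2) (by linarith) h₂
  rw [neg_sub] at e2
  have e3 : bracket x ^ (-M) = bracket x ^ (-2 : ℝ) * bracket x ^ (2 - M) := by
    rw [← Real.rpow_add hbx]; congr 1; ring
  have e4 : (2 : ℝ) ^ M = 2 ^ (2 : ℝ) * 2 ^ (M - 2) := by
    rw [← Real.rpow_add (by norm_num)]; congr 1; ring
  have e5 : bracket k₁ ^ (-2 : ℝ) = (bracket k₁ ^ 2)⁻¹ := by
    rw [Real.rpow_neg hb1.le, Real.rpow_two]
  calc profile M x * profile M y
      ≤ (2 ^ (M / 4) * ((2 ^ (2 : ℝ) * bracket k₁ ^ (-2 : ℝ)) *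
          (2 ^ (M - 2) * bracket k₂ ^ (2 - M)))) * (2 ^ (M / 4) * bracket y ^ (2 - M)) := by
        refine mul_le_mul ((profile_le (by linarith) x).trans ?_)
          ((profile_le (by linarith) y).trans ?_) (profile_pos M y).le (by positivity)
        · rw [e3]
          gcongr
        · exact mul_le_mul_of_nonneg_left (bracket_rpow_neg_le M y) (by positivity)
    _ = _ := by rw [e4, e5]; ring

/-- Upper bound of the collision integrand, when `x` is the larger outgoing wave vector. -/
lemma gain_le {M A η : ℝ} (hM : 2 ≤ M) (hA : 2 ≤ A) (hη : 0 ≤ η) {N : ℕ} {k₁ k₂ x y : Wave}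
    (hk₁ : 1 ≤ ‖k₁‖) (hcos : 1 - η ≤ Real.cos (N * ‖k₁‖ ^ 2))
    (he : ‖x‖ ^ 2 + ‖y‖ ^ 2 = ‖k₁‖ ^ 2 + ‖k₂‖ ^ 2) (hyx : ‖y‖ ≤ ‖x‖) :
    datum M A N k₂ * datum M A N y * (datum M A N x - datum M A N k₁) +
        datum M A N k₁ * datum M A N x * datum M A N y ≤
      -(profile M k₁ * (datum M A N k₂ * datum M A N y * (1 - Real.cos (N * ‖x‖ ^ 2)))) +
        profile M k₁ * ((2 ^ (M / 4)) ^ 2 * (4 * A ^ 2 * η +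
          8 * A ^ 3 * (2 * M * 4 ^ (M / 4) + 2 ^ M) / bracket k₁ ^ 2)) *
          (bracket k₂ ^ (2 - M) * bracket y ^ (2 - M)) := by
  obtain ⟨hb1, hb2⟩ := bracket_le_two_mul he rfl (norm_nonneg _) hyx
  have hyx2 : ‖y‖ ^ 2 ≤ ‖x‖ ^ 2 := by gcongr
  have hd : |‖x‖ ^ 2 - ‖k₁‖ ^ 2| ≤ ‖k₂‖ ^ 2 + ‖y‖ ^ 2 := by
    rw [abs_le]
    constructor <;> nlinarith [sq_nonneg ‖k₂‖, sq_nonneg ‖y‖]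
  have hM0 : 0 ≤ M := by linarith
  have hA1 : 1 ≤ A := by linarith
  have hp := abs_profile_sub_le hM0 hk₁ (by nlinarith [sq_nonneg ‖k₂‖]) hd
  have hp1 := profile_pos M k₁
  have hp2 := profile_pos M k₂
  have hpx := profile_pos M x
  have hpy := profile_pos M y
  have hb0 := bracket_pos k₁
  have hf2 := (datum_pos (M := M) hA N k₂).le
  have hfy := (datum_pos (M := M) hA N y).le
  have hq1 := profile_mul_le hM0 k₂ y
  have hq2 := profile_mul_le' hM0 k₂ y
  have hq3 := profile_out_mul_le hM (k₁ := k₁) (k₂ := k₂) (x := x) (y := y) hb1 hb2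
  set E := bracket k₂ ^ (2 - M) * bracket y ^ (2 - M) with hE
  set H := ((2 : ℝ) ^ (M / 4)) ^ 2 with hH
  have hf2y : datum M A N k₂ * datum M A N y ≤ 4 * A ^ 2 * (profile M k₂ * profile M y) := by
    calc datum M A N k₂ * datum M A N y ≤ (2 * A * profile M k₂) * (2 * A * profile M y) := by
          gcongr <;> exact datum_le hA1 N _
      _ = _ := by ring
  have hdiff : datum M A N x - datum M A N k₁ ≤
      2 * A * (2 * M * 4 ^ (M / 4) * (profile M k₁ * (‖k₂‖ ^ 2 + ‖y‖ ^ 2) / bracket k₁ ^ 2)) +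
        profile M k₁ * (η - (1 - Real.cos (N * ‖x‖ ^ 2))) := by
    rw [datum_eq, datum_eq]
    set cx := Real.cos (N * ‖x‖ ^ 2) with hcx
    have e1 : (A + cx) * (profile M x - profile M k₁) ≤
        2 * A * (2 * M * 4 ^ (M / 4) * (profile M k₁ * (‖k₂‖ ^ 2 + ‖y‖ ^ 2) / bracket k₁ ^ 2)) := by
      have h0 : 0 ≤ A + cx := by linarith [Real.neg_one_le_cos (N * ‖x‖ ^ 2)]
      have h1 : A + cx ≤ 2 * A := by linarith [Real.cos_le_one (N * ‖x‖ ^ 2)]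
      calc (A + cx) * (profile M x - profile M k₁)
          ≤ (A + cx) * |profile M x - profile M k₁| := by gcongr; exact le_abs_self _
        _ ≤ _ := by gcongr
    have e2 : profile M k₁ * (cx - Real.cos (N * ‖k₁‖ ^ 2)) ≤ profile M k₁ * (η - (1 - cx)) :=
      mul_le_mul_of_nonneg_left (by linarith) hp1.le
    linarith
  have t1 : datum M A N k₂ * datum M A N y * (datum M A N x - datum M A N k₁) ≤
      4 * A ^ 2 * (2 * A) * (2 * M * 4 ^ (M / 4)) * profile M k₁ / bracket k₁ ^ 2 * (H * E) +
        4 * A ^ 2 * η * profile M k₁ * (H * E) -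
        profile M k₁ * (datum M A N k₂ * datum M A N y * (1 - Real.cos (N * ‖x‖ ^ 2))) := by
    have s1 := mul_le_mul_of_nonneg_left hdiff (mul_nonneg hf2 hfy)
    have s2 : datum M A N k₂ * datum M A N y * (2 * A * (2 * M * 4 ^ (M / 4) *
        (profile M k₁ * (‖k₂‖ ^ 2 + ‖y‖ ^ 2) / bracket k₁ ^ 2))) ≤
        4 * A ^ 2 * (2 * A) * (2 * M * 4 ^ (M / 4)) * profile M k₁ / bracket k₁ ^ 2 * (H * E) := by
      calc _ ≤ 4 * A ^ 2 * (profile M k₂ * profile M y) * (2 * A * (2 * M * 4 ^ (M / 4) *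
            (profile M k₁ * (‖k₂‖ ^ 2 + ‖y‖ ^ 2) / bracket k₁ ^ 2))) := by gcongr
        _ = 4 * A ^ 2 * (2 * A) * (2 * M * 4 ^ (M / 4)) * profile M k₁ / bracket k₁ ^ 2 *
            (profile M k₂ * profile M y * (‖k₂‖ ^ 2 + ‖y‖ ^ 2)) := by ring
        _ ≤ _ := by gcongr
    have s3 : datum M A N k₂ * datum M A N y * (profile M k₁ * η) ≤
        4 * A ^ 2 * η * profile M k₁ * (H * E) := by
      calc _ ≤ 4 * A ^ 2 * (profile M k₂ * profile M y) * (profile M k₁ * η) := by gcongr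
        _ = 4 * A ^ 2 * η * profile M k₁ * (profile M k₂ * profile M y) := by ring
        _ ≤ _ := by gcongr
    linarith
  have t2 : datum M A N k₁ * datum M A N x * datum M A N y ≤
      8 * A ^ 3 * profile M k₁ * (H * 2 ^ M * E / bracket k₁ ^ 2) := by
    calc datum M A N k₁ * datum M A N x * datum M A N y
        ≤ (2 * A * profile M k₁) * (2 * A * profile M x) * (2 * A * profile M y) := by
          have := (datum_pos (M := M) hA N k₁).le
          have := (datum_pos (M := M) hA N x).le
          gcongr <;> exact datum_le hA1 N _
      _ = 8 * A ^ 3 * profile M k₁ * (profile M x * profile M y) := by ring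
      _ ≤ _ := by gcongr
  refine (add_le_add t1 t2).trans (le_of_eq ?_)
  ring

lemma exists_bal_datum_le {M : ℝ} (hM : 2 ≤ M) :
    ∃ c C : ℝ, 0 < c ∧ 0 < C ∧ ∀ (A η : ℝ) (N : ℕ) (k₁ : Wave) (q : Wave × Sph), 2 ≤ A → 0 ≤ η →
      2 ≤ ‖k₁‖ → 1 - η ≤ Real.cos (N * ‖k₁‖ ^ 2) →
        bal (datum M A N) k₁ q ≤ profile M k₁ * (-(c * A ^ 2 * osc N k₁ q) +
          C * (A ^ 2 * η + A ^ 3 / bracket k₁ ^ 2) * weight M k₁ q) := by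
  set H := ((2 : ℝ) ^ (M / 4)) ^ 2 with hH
  set D := 2 * M * 4 ^ (M / 4) + (2 : ℝ) ^ M with hD
  have hD0 : 0 ≤ D := by positivity
  refine ⟨(1 / 4) * ((5 : ℝ) ^ (-(M / 4)) * 5 ^ (-(M / 4))), H * (4 + 8 * D), by positivity,
    by positivity, fun A η N k₁ q hA hη hk₁ hcos => ?_⟩
  have hp1 := profile_pos M k₁
  have hf1 := (datum_pos (M := M) hA N k₁).le
  have hf2 := (datum_pos (M := M) hA N q.1).le
  have hf3 := (datum_pos (M := M) hA N (out₁ k₁ q.1 q.2)).le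
  have hf4 := (datum_pos (M := M) hA N (out₂ k₁ q.1 q.2)).le
  have hb1 := bracket_pos k₁
  have hb2 := bracket_pos q.1
  have hb3 := bracket_pos (out₁ k₁ q.1 q.2)
  have hb4 := bracket_pos (out₂ k₁ q.1 q.2)
  have he := energy k₁ q.1 q.2
  have hcoef : H * (4 * A ^ 2 * η + 8 * A ^ 3 * D / bracket k₁ ^ 2) ≤
      H * (4 + 8 * D) * (A ^ 2 * η + A ^ 3 / bracket k₁ ^ 2) := by
    have e1 : 0 ≤ D * (A ^ 2 * η) := by positivity
    have e2 : 0 ≤ A ^ 3 / bracket k₁ ^ 2 := by positivity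
    have e3 : 8 * A ^ 3 * D / bracket k₁ ^ 2 = 8 * D * (A ^ 3 / bracket k₁ ^ 2) := by ring
    have e4 : 4 * A ^ 2 * η + 8 * A ^ 3 * D / bracket k₁ ^ 2 ≤
        (4 + 8 * D) * (A ^ 2 * η + A ^ 3 / bracket k₁ ^ 2) := by
      rw [e3]
      linarith
    rw [mul_assoc H]
    exact mul_le_mul_of_nonneg_left e4 (by positivity)
  have hone : ∀ k : Wave, 0 ≤ 1 - Real.cos (N * ‖k‖ ^ 2) := fun k =>
    sub_nonneg.2 (Real.cos_le_one _)
  have hcw : ∀ E : ℝ, 0 ≤ E → E ≤ weight M k₁ q →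
      profile M k₁ * (H * (4 * A ^ 2 * η + 8 * A ^ 3 * D / bracket k₁ ^ 2)) * E ≤
        profile M k₁ * (H * (4 + 8 * D) * (A ^ 2 * η + A ^ 3 / bracket k₁ ^ 2) *
          weight M k₁ q) := by
    intro E hE hEw
    rw [mul_assoc]
    gcongr
  rcases le_total ‖out₂ k₁ q.1 q.2‖ ‖out₁ k₁ q.1 q.2‖ with h | h
  · have hg := gain_le (M := M) (A := A) (N := N) hM hA hη (by linarith) hcos he h
    have hE := hcw (bracket q.1 ^ (2 - M) * bracket (out₂ k₁ q.1 q.2) ^ (2 - M)) (by positivity)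
      (mul_le_mul_of_nonneg_left (le_add_of_nonneg_left (by positivity)) (by positivity))
    have hosc : (1 / 4) * ((5 : ℝ) ^ (-(M / 4)) * 5 ^ (-(M / 4))) * A ^ 2 * osc N k₁ q ≤
        datum M A N q.1 * datum M A N (out₂ k₁ q.1 q.2) *
          (1 - Real.cos (N * ‖out₁ k₁ q.1 q.2‖ ^ 2)) := by
      by_cases hq : q ∈ resSet k₁
      · have hp : ∀ k : Wave, ‖k‖ ^ 2 ≤ 2 → A / 2 * (5 : ℝ) ^ (-(M / 4)) ≤ datum M A N k := by
          intro k hk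
          refine (mul_le_mul_of_nonneg_left ?_ (by linarith)).trans (le_datum hA N k)
          refine Real.rpow_le_rpow_of_nonpos (by positivity) ?_ (by linarith)
          nlinarith [sq_nonneg ‖k‖]
        rw [osc, Set.indicator_of_mem hq]
        refine mul_le_mul_of_nonneg_right ?_ (hone _)
        calc _ = (A / 2 * (5 : ℝ) ^ (-(M / 4))) * (A / 2 * (5 : ℝ) ^ (-(M / 4))) := by ring
          _ ≤ _ := by
            refine mul_le_mul (hp _ ?_) (hp _ hq.2.2) (by positivity) hf2
            nlinarith [hq.1.2, norm_nonneg q.1]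
      · rw [osc, Set.indicator_of_notMem hq, mul_zero]
        have := hone (out₁ k₁ q.1 q.2)
        positivity
    have hosc' := mul_le_mul_of_nonneg_left hosc hp1.le
    have hneg : 0 ≤ datum M A N k₁ * datum M A N q.1 * datum M A N (out₁ k₁ q.1 q.2) := by
      positivity
    refine le_trans ?_ (hg.trans ?_)
    · unfold bal gainLoss
      linarith only [hneg]
    · refine (add_le_add (neg_le_neg hosc') hE).trans (le_of_eq ?_)
      rw [← mul_neg, ← mul_add]
  · rw [add_comm] at he
    have hg := gain_le (M := M) (A := A) (N := N) hM hA hη (by linarith) hcos he h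
    have hE := hcw (bracket q.1 ^ (2 - M) * bracket (out₁ k₁ q.1 q.2) ^ (2 - M)) (by positivity)
      (mul_le_mul_of_nonneg_left (le_add_of_nonneg_right (by positivity)) (by positivity))
    have hosc : osc N k₁ q = 0 := by
      refine Set.indicator_of_notMem (fun hq => ?_) _
      have h2 := hq.2.2
      have h3 : ‖out₁ k₁ q.1 q.2‖ ^ 2 ≤ ‖out₂ k₁ q.1 q.2‖ ^ 2 := by gcongr
      have h4 : 1 / 2 ≤ ‖q.1‖ := hq.1.1
      nlinarith
    have hneg : 0 ≤ datum M A N k₁ * datum M A N q.1 * datum M A N (out₂ k₁ q.1 q.2) := by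
      positivity
    have hneg' : 0 ≤ profile M k₁ * (datum M A N q.1 * datum M A N (out₁ k₁ q.1 q.2) *
        (1 - Real.cos (N * ‖out₂ k₁ q.1 q.2‖ ^ 2))) := by
      have := hone (out₂ k₁ q.1 q.2)
      positivity
    rw [hosc, mul_zero, neg_zero, zero_add]
    refine le_trans ?_ (hg.trans ((add_le_add (neg_nonpos.2 hneg') hE).trans (zero_add _).le))
    unfold bal gainLoss
    linarith only [hneg]

lemma abs_datum_le {M A : ℝ} (hM : 0 ≤ M) (hA : 2 ≤ A) (N : ℕ) (k : Wave) :
    |datum M A N k| ≤ 2 * A * 2 ^ (M / 4) * bracket k ^ (-M) := by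
  rw [abs_of_pos (datum_pos hA N k), mul_assoc]
  exact (datum_le (by linarith) N k).trans
    (mul_le_mul_of_nonneg_left (profile_le hM k) (by linarith))

/-- The collision operator loses weight on the oscillating datum, near the resonant spheres. -/
theorem exists_collision_datum_le {β M : ℝ} (hβ : 1 / 4 < β) (hβ' : β ≤ 1) (hM : 10 < M) :
    ∃ c η : ℝ, 0 < c ∧ 0 < η ∧ ∀ A : ℝ, 2 ≤ A → ∃ R : ℝ, ∀ (N : ℕ) (k : Wave), 4 ≤ N → R ≤ ‖k‖ →
      1 - η ≤ Real.cos (N * ‖k‖ ^ 2) →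
        collision β (datum M A N) k ≤ -(c * A ^ 2 * ‖k‖ ^ (4 * β - 1 - M)) := by
  obtain ⟨c₀, C, hc₀, hC, hbal⟩ := exists_bal_datum_le (M := M) (by linarith)
  obtain ⟨K, hK, hKint⟩ := exists_integral_kern_weight_le (β := β) (by linarith) hβ' hM
  obtain ⟨c₁, hc₁, hosc⟩ := exists_le_lintegral_kern_osc (β := β) (by linarith) hβ'
  set c := c₀ * c₁ with hc
  have hc0 : 0 < c := by positivity
  set η := c / (32 * C * K) with hη
  have hη0 : 0 < η := by positivity
  refine ⟨2 ^ (-M) * c / 16, η, by positivity, hη0, fun A hA => ?_⟩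
  refine ⟨max 2 (A * (32 * C * K) / c), fun N k₁ hN hR hcos => ?_⟩
  have hk2 : 2 ≤ ‖k₁‖ := (le_max_left _ _).trans hR
  have hkR : A * (32 * C * K) / c ≤ ‖k₁‖ := (le_max_right _ _).trans hR
  have hk0 : 0 < ‖k₁‖ := by linarith
  have hb := bracket_pos k₁
  have hp1 := profile_pos M k₁
  have hM0 : 0 ≤ M := by linarith
  obtain ⟨hint, hle⟩ := hKint k₁
  have hiosc : Integrable (fun q => kern β k₁ q * osc N k₁ q)
    ((volume : Measure Wave).prod surface) := integrable_kern_osc (by linarith) hint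
  have hoscle : c₁ * ‖k₁‖ ^ (4 * β - 1) ≤
      ∫ q, kern β k₁ q * osc N k₁ q ∂((volume : Measure Wave).prod surface) := by
    have h1 := hosc N k₁ (by exact_mod_cast hN) hk2
    rw [← ofReal_integral_eq_lintegral_ofReal hiosc (Eventually.of_forall fun q =>
      mul_nonneg (kern_nonneg _ _ _) (osc_nonneg _ _ _))] at h1
    exact (ENNReal.ofReal_le_ofReal_iff (integral_nonneg fun q =>
      mul_nonneg (kern_nonneg _ _ _) (osc_nonneg _ _ _))).1 h1
  obtain ⟨G, hG0, hG⟩ : ∃ G : ℝ, 0 ≤ G ∧ ∀ k, |datum M A N k| ≤ G * bracket k ^ (-M) :=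
    ⟨2 * A * 2 ^ (M / 4), by positivity, abs_datum_le hM0 hA N⟩
  have hibal : Integrable (fun q => kern β k₁ q * bal (datum M A N) k₁ q)
      ((volume : Measure Wave).prod surface) := by
    refine integrable_kern_mul (D := 3 * G * G ^ 2 * (2 * 2 ^ M + 1) * bracket k₁ ^ (-M)) hint
      (measurable_bal (measurable_datum M A N) k₁) (Eventually.of_forall fun q => ?_)
    have := abs_bal_sub_le (f := datum M A N) (g := 0) (k₁ := k₁) (q := q) hM0 hG0
      (fun k _ => ⟨hG k, by
        have := bracket_pos k
        simp only [Pi.zero_apply, abs_zero]; positivity, by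
        simpa using hG k⟩)
    simpa [bal, gainLoss, mul_assoc] using this
  set δ := C * (A ^ 2 * η + A ^ 3 / bracket k₁ ^ 2) with hδ
  have hmain : ∫ q, kern β k₁ q * bal (datum M A N) k₁ q ∂((volume : Measure Wave).prod surface) ≤
      profile M k₁ * (-(c₀ * A ^ 2 *
        ∫ q, kern β k₁ q * osc N k₁ q ∂((volume : Measure Wave).prod surface)) +
        δ * ∫ q, kern β k₁ q * weight M k₁ q ∂((volume : Measure Wave).prod surface)) := by
    have i1 : Integrable (fun q => -(c₀ * A ^ 2 * (kern β k₁ q * osc N k₁ q)))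
        ((volume : Measure Wave).prod surface) := (hiosc.const_mul _).neg
    have i2 : Integrable (fun q => δ * (kern β k₁ q * weight M k₁ q))
        ((volume : Measure Wave).prod surface) := hint.const_mul _
    rw [← integral_const_mul, ← integral_const_mul, ← integral_neg, ← integral_add i1 i2,
      ← integral_const_mul]
    refine integral_mono hibal ((i1.add i2).const_mul _) fun q => ?_
    have := mul_le_mul_of_nonneg_left (hbal A η N k₁ q hA hη0.le hk2 hcos) (kern_nonneg β k₁ q)
    refine this.trans (le_of_eq ?_)
    ring
  have hb8 : bracket k₁ ^ (4 * β - 1) ≤ 8 * ‖k₁‖ ^ (4 * β - 1) := by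
    have h1 : bracket k₁ ≤ 2 * ‖k₁‖ := by
      refine le_of_sq_le_sq ?_ (by positivity)
      rw [bracket_sq]
      nlinarith
    calc bracket k₁ ^ (4 * β - 1) ≤ (2 * ‖k₁‖) ^ (4 * β - 1) :=
          Real.rpow_le_rpow hb.le h1 (by linarith)
      _ = 2 ^ (4 * β - 1) * ‖k₁‖ ^ (4 * β - 1) := Real.mul_rpow (by norm_num) hk0.le
      _ ≤ 2 ^ (3 : ℝ) * ‖k₁‖ ^ (4 * β - 1) := by
          gcongr
          · norm_num
          · linarith
      _ = _ := by norm_num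
  set P := ‖k₁‖ ^ (4 * β - 1) with hP
  have hP0 : 0 < P := by positivity
  have hδle : δ * (K * (8 * P)) ≤ A ^ 2 * c / 2 * P := by
    have e1 : A ^ 3 / bracket k₁ ^ 2 ≤ A ^ 2 * η := by
      have h1 : ‖k₁‖ ≤ bracket k₁ ^ 2 := by
        rw [bracket_sq]
        nlinarith
      have h2 : A ≤ η * bracket k₁ ^ 2 := by
        calc A = η * (A * (32 * C * K) / c) := by rw [hη]; field_simp
          _ ≤ η * bracket k₁ ^ 2 := by
            gcongr
            exact hkR.trans h1
      rw [div_le_iff₀ (by positivity)]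
      nlinarith [sq_nonneg A]
    have e2 : δ ≤ C * (2 * (A ^ 2 * η)) := by
      rw [hδ]
      gcongr
      linarith
    calc δ * (K * (8 * P)) ≤ C * (2 * (A ^ 2 * η)) * (K * (8 * P)) := by gcongr
      _ = A ^ 2 * c / 2 * P := by rw [hη]; field_simp; ring
  have hδ0 : 0 ≤ δ := by positivity
  have hfin : -(c₀ * A ^ 2 * ∫ q, kern β k₁ q * osc N k₁ q ∂((volume : Measure Wave).prod surface)) +
      δ * ∫ q, kern β k₁ q * weight M k₁ q ∂((volume : Measure Wave).prod surface) ≤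
        -(A ^ 2 * c / 2 * P) := by
    have e1 := mul_le_mul_of_nonneg_left hoscle (show 0 ≤ c₀ * A ^ 2 by positivity)
    have e2 := mul_le_mul_of_nonneg_left (hle.trans (mul_le_mul_of_nonneg_left hb8 hK.le)) hδ0
    have e3 : c₀ * A ^ 2 * (c₁ * P) = A ^ 2 * c * P := by rw [hc]; ring
    linarith
  have hprof : 2 ^ (-M) * ‖k₁‖ ^ (-M) ≤ profile M k₁ := by
    refine le_trans ?_ (bracket_rpow_le_profile hM0 k₁)
    rw [← Real.mul_rpow (by norm_num) hk0.le]
    refine Real.rpow_le_rpow_of_nonpos hb ?_ (by linarith)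
    refine le_of_sq_le_sq ?_ (by positivity)
    rw [bracket_sq]
    nlinarith
  have hpow : ‖k₁‖ ^ (4 * β - 1 - M) = P * ‖k₁‖ ^ (-M) := by
    rw [hP, ← Real.rpow_add hk0]; congr 1
  have e4 := hmain.trans (mul_le_mul_of_nonneg_left hfin hp1.le)
  have e5 := mul_le_mul_of_nonneg_right hprof (show 0 ≤ A ^ 2 * c / 2 * P by positivity)
  rw [collision_eq, hpow]
  linarith

lemma ae_abs_le_of_wNorm_le {M ε : ℝ} (hε : 0 ≤ ε) {f : Wave → ℝ}
    (h : wNorm M f ≤ ENNReal.ofReal ε) : ∀ᵐ k : Wave, |f k| ≤ ε * bracket k ^ (-M) := by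
  rw [wNorm, eLpNorm_exponent_top] at h
  filter_upwards [ae_le_eLpNormEssSup (f := fun k => bracket k ^ M * f k) (μ := volume)] with k hk
  have hb := bracket_pos k
  have h1 := hk.trans h
  rw [Real.enorm_eq_ofReal_abs, ENNReal.ofReal_le_ofReal_iff hε, abs_mul,
    abs_of_pos (by positivity)] at h1
  rw [Real.rpow_neg hb.le, ← div_eq_mul_inv, le_div_iff₀ (by positivity)]
  linarith

lemma memW_of_abs_le {M G : ℝ} {f : Wave → ℝ} (hf : Measurable f)
    (h : ∀ k, |f k| ≤ G * bracket k ^ (-M)) : MemW M f := by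
  refine memLp_top_of_bound (by fun_prop) G (Eventually.of_forall fun k => ?_)
  have hb := bracket_pos k
  have := h k
  rw [Real.rpow_neg hb.le, ← div_eq_mul_inv, le_div_iff₀ (by positivity)] at this
  rw [Real.norm_eq_abs, abs_mul, abs_of_pos (by positivity)]
  linarith

lemma measurable_collision {β : ℝ} {f : ℝ → Wave → ℝ} (hf : Measurable (Function.uncurry f)) :
    Measurable fun p : ℝ × Wave => collision β (f p.1) p.2 := by
  have h1 : Measurable fun p : (ℝ × Wave) × (Wave × Sph) => f p.1.1 (out₁ p.1.2 p.2.1 p.2.2) := by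
    unfold out₁
    exact hf.comp (g := Function.uncurry f) (f := fun p : (ℝ × Wave) × (Wave × Sph) =>
      (p.1.1, (1 / 2 : ℝ) • (p.1.2 + p.2.1) + (‖p.1.2 - p.2.1‖ / 2) • (p.2.2 : Wave)))
      (by fun_prop)
  have h2 : Measurable fun p : (ℝ × Wave) × (Wave × Sph) => f p.1.1 (out₂ p.1.2 p.2.1 p.2.2) := by
    unfold out₂
    exact hf.comp (g := Function.uncurry f) (f := fun p : (ℝ × Wave) × (Wave × Sph) =>
      (p.1.1, (1 / 2 : ℝ) • (p.1.2 + p.2.1) - (‖p.1.2 - p.2.1‖ / 2) • (p.2.2 : Wave)))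
      (by fun_prop)
  have h3 : Measurable fun p : (ℝ × Wave) × (Wave × Sph) => f p.1.1 p.1.2 :=
    hf.comp (g := Function.uncurry f) (f := fun p : (ℝ × Wave) × (Wave × Sph) =>
      (p.1.1, p.1.2)) (by fun_prop)
  have h4 : Measurable fun p : (ℝ × Wave) × (Wave × Sph) => f p.1.1 p.2.1 :=
    hf.comp (g := Function.uncurry f) (f := fun p : (ℝ × Wave) × (Wave × Sph) =>
      (p.1.1, p.2.1)) (by fun_prop)
  have h5 : Measurable fun p : (ℝ × Wave) × (Wave × Sph) =>
      kern β p.1.2 p.2 * bal (f p.1.1) p.1.2 p.2 := by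
    unfold kern bal gainLoss
    refine Measurable.mul ?_ (by fun_prop)
    unfold out₁ out₂
    fun_prop
  simp_rw [collision_eq]
  exact (h5.stronglyMeasurable.integral_prod_right').measurable.const_mul _

/-- A datum on which the collision operator loses too much weight launches no strong solution. -/
theorem not_isStrongSolution {β M c G T : ℝ} (hβ : 1 / 4 < β) (hβ' : β ≤ 1) (hM : 10 < M)
    (hc : 0 < c) (hG : 0 ≤ G) {g : Wave → ℝ} (hgm : Measurable g)
    (hg : ∀ k, |g k| ≤ G * bracket k ^ (-M))
    (hE : ∀ R : ℝ, ∃ E : Set Wave, volume E ≠ 0 ∧ ∀ k ∈ E, R ≤ ‖k‖ ∧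
      collision β g k ≤ -(c * ‖k‖ ^ (4 * β - 1 - M))) (hT : 0 < T) (f : ℝ → Wave → ℝ) :
    ¬ IsStrongSolution β M T g f := by
  intro hf
  obtain ⟨K, hK, hlip⟩ := exists_collision_sub_le (β := β) (by linarith) hβ' hM
  set ε := min 1 (c / (2 * ((G + 1) ^ 2 * K))) with hε
  have hε0 : 0 < ε := lt_min one_pos (by positivity)
  have hε1 : ε ≤ 1 := min_le_left _ _
  have hεc : ε * (G + 1) ^ 2 * K ≤ c / 2 := by
    calc ε * (G + 1) ^ 2 * K ≤ (c / (2 * ((G + 1) ^ 2 * K))) * (G + 1) ^ 2 * K := by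
          gcongr
          exact min_le_right _ _
      _ = c / 2 := by field_simp
  have h00 : (0 : ℝ) ∈ Set.Icc 0 T := ⟨le_rfl, hT.le⟩
  have hf0 : ∀ᵐ k : Wave, f 0 k = g k := by
    filter_upwards [hf.duhamel 0 h00] with k hk
    simpa using hk.2
  obtain ⟨t, ht0, htT, ht⟩ : ∃ t : ℝ, 0 < t ∧ t ≤ T ∧ ∀ s ∈ Set.Icc 0 t,
      wNorm M (fun k => f s k - f 0 k) ≤ ENNReal.ofReal ε := by
    have h1 : ∀ᶠ s in 𝓝[Set.Icc 0 T] 0, wNorm M (fun k => f s k - f 0 k) < ENNReal.ofReal ε :=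
      (hf.continuous 0 h00).eventually_lt_const (ENNReal.ofReal_pos.2 hε0)
    obtain ⟨d, hd, h2⟩ := Metric.mem_nhdsWithin_iff.1 h1
    refine ⟨min T (d / 2), lt_min hT (by positivity), min_le_left _ _, fun s hs => ?_⟩
    have hsT := hs.2.trans (min_le_left _ _)
    have hsd := hs.2.trans (min_le_right _ _)
    refine (h2 ⟨?_, hs.1, hsT⟩).le
    rw [Metric.mem_ball, Real.dist_eq, sub_zero, abs_of_nonneg hs.1]
    linarith
  have hclose : ∀ s ∈ Set.Icc 0 t, ∀ᵐ k : Wave, |f s k - g k| ≤ ε * bracket k ^ (-M) := by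
    intro s hs
    filter_upwards [ae_abs_le_of_wNorm_le hε0.le (ht s hs), hf0] with k hk hk0
    rwa [hk0] at hk
  have hcol : ∀ᵐ s ∂(volume.restrict (Set.Ioc 0 t)), ∀ᵐ k : Wave,
      collision β (f s) k ≤ collision β g k + c / 2 * bracket k ^ (4 * β - 1 - M) := by
    refine (ae_restrict_mem measurableSet_Ioc).mono fun s hs => ?_
    have hs' : s ∈ Set.Icc 0 t := ⟨hs.1.le, hs.2⟩
    have hb : ∀ᵐ k : Wave, |f s k| ≤ (G + 1) * bracket k ^ (-M) ∧
        |g k| ≤ (G + 1) * bracket k ^ (-M) ∧ |f s k - g k| ≤ ε * bracket k ^ (-M) := by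
      filter_upwards [hclose s hs'] with k hk
      have hp : 0 ≤ bracket k ^ (-M) := Real.rpow_nonneg (bracket_pos k).le _
      have h1 := hg k
      have h2 : ε * bracket k ^ (-M) ≤ 1 * bracket k ^ (-M) := by gcongr
      refine ⟨?_, by linarith, hk⟩
      have h3 := abs_add_le (f s k - g k) (g k)
      rw [sub_add_cancel] at h3
      linarith
    filter_upwards [hlip (G + 1) ε (f s) g (by positivity) hε0.le
      (hf.measurable.comp (g := Function.uncurry f) (f := fun k => (s, k)) (by fun_prop)) hgm hb]
      with k hk
    have hp : 0 ≤ bracket k ^ (4 * β - 1 - M) := Real.rpow_nonneg (bracket_pos k).le _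
    have h1 := mul_le_mul_of_nonneg_right hεc hp
    have h2 := (abs_le.1 hk).2
    linarith
  have hmeas : MeasurableSet {p : ℝ × Wave | collision β (f p.1) p.2 ≤
      collision β g p.2 + c / 2 * bracket p.2 ^ (4 * β - 1 - M)} := by
    refine measurableSet_le (measurable_collision hf.measurable) (Measurable.add ?_ (by fun_prop))
    exact (measurable_collision (β := β) (f := fun _ => g) (hgm.comp measurable_snd)).comp
      (g := fun p : ℝ × Wave => collision β g p.2) measurable_id
  have hcol' := (Measure.ae_ae_comm hmeas).1 hcol
  have htend := tendsto_rpow_atTop (show 0 < 4 * β - 1 by linarith)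
  obtain ⟨R, hR⟩ := eventually_atTop.1 (htend.eventually_gt_atTop (2 / (t * c)))
  obtain ⟨E, hE0, hEk⟩ := hE (max R 1)
  have htm : t ∈ Set.Icc 0 T := ⟨ht0.le, htT⟩
  have hall := (hcol'.and (hf.duhamel t htm)).and (hclose t ⟨ht0.le, le_rfl⟩)
  obtain ⟨k, hkE, ⟨hk1, hki, hk2⟩, hk3⟩ := Measure.exists_mem_of_measure_ne_zero_of_ae hE0
    (ae_restrict_of_ae hall)
  obtain ⟨hkR, hkc⟩ := hEk k hkE
  have hk1' : 1 ≤ ‖k‖ := (le_max_right _ _).trans hkR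
  have hk0 : 0 < ‖k‖ := by linarith
  have hb := bracket_pos k
  have hnb := norm_le_bracket k
  have hpw : bracket k ^ (4 * β - 1 - M) ≤ ‖k‖ ^ (4 * β - 1 - M) :=
    Real.rpow_le_rpow_of_nonpos hk0 hnb (by linarith)
  set P := ‖k‖ ^ (4 * β - 1 - M) with hP
  have hint : ∫ s in (0 : ℝ)..t, collision β (f s) k ≤ ∫ _s in (0 : ℝ)..t, -(c / 2 * P) := by
    rw [intervalIntegral.integral_of_le ht0.le, intervalIntegral.integral_of_le ht0.le]
    refine setIntegral_mono_ae_restrict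
      ((intervalIntegrable_iff_integrableOn_Ioc_of_le ht0.le).1 hki)
      (integrableOn_const measure_Ioc_lt_top.ne) ?_
    filter_upwards [hk1] with s hs
    have := mul_le_mul_of_nonneg_left hpw (show 0 ≤ c / 2 by positivity)
    linarith
  rw [intervalIntegral.integral_const, sub_zero, smul_eq_mul] at hint
  have h4 : bracket k ^ (-M) ≤ ‖k‖ ^ (-M) := Real.rpow_le_rpow_of_nonpos hk0 hnb (by linarith)
  have h5 : ε * bracket k ^ (-M) ≤ 1 * ‖k‖ ^ (-M) := by
    gcongr
  have h6 : P = ‖k‖ ^ (4 * β - 1) * ‖k‖ ^ (-M) := by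
    rw [hP, ← Real.rpow_add hk0]; congr 1
  have h7 := hR ‖k‖ ((le_max_left _ _).trans hkR)
  have h8 : 0 < ‖k‖ ^ (-M) := by positivity
  rw [div_lt_iff₀ (by positivity)] at h7
  have h9 := (abs_le.1 hk3).1
  rw [hk2] at h9
  have h10 := mul_lt_mul_of_pos_right h7 h8
  rw [h6] at hint
  linarith

lemma collision_const_mul (β r : ℝ) (f : Wave → ℝ) (k : Wave) :
    collision β (fun k => r * f k) k = r ^ 3 * collision β f k := by
  rw [collision_eq, collision_eq, mul_left_comm, ← integral_const_mul (r ^ 3)]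
  congr 2
  funext q
  unfold bal gainLoss
  ring

lemma exists_norm_sq_eq {R : ℝ} (N : ℕ) (hN : 0 < N) :
    ∃ k : Wave, R < ‖k‖ ∧ Real.cos (N * ‖k‖ ^ 2) = 1 := by
  have hN0 : (0 : ℝ) < N := by exact_mod_cast hN
  obtain ⟨B, hB⟩ := exists_nat_gt (N * R ^ 2 / (2 * Real.pi))
  have hB0 : 0 ≤ 2 * Real.pi * B / N := by positivity
  obtain ⟨k, hk⟩ := exists_norm_eq Wave (Real.sqrt_nonneg (2 * Real.pi * B / N))
  have hk2 : ‖k‖ ^ 2 = 2 * Real.pi * B / N := by rw [hk, Real.sq_sqrt hB0]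
  refine ⟨k, ?_, ?_⟩
  · refine lt_of_pow_lt_pow_left₀ 2 (norm_nonneg _) ?_
    rw [hk2, lt_div_iff₀ hN0]
    rw [div_lt_iff₀ (by positivity)] at hB
    linarith
  · rw [hk2, show (N : ℝ) * (2 * Real.pi * B / N) = B * (2 * Real.pi) by field_simp,
      Real.cos_nat_mul_two_pi]

lemma datum_not_isStrongSolution {β M c η A r T R : ℝ} {N : ℕ} (hβ : 1 / 4 < β) (hβ' : β ≤ 1)
    (hM : 10 < M) (hc : 0 < c) (hη : 0 < η) (hA : 2 ≤ A) (hN : 0 < N)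
    (h : ∀ k : Wave, R ≤ ‖k‖ → 1 - η ≤ Real.cos (N * ‖k‖ ^ 2) →
      collision β (datum M A N) k ≤ -(c * A ^ 2 * ‖k‖ ^ (4 * β - 1 - M)))
    (hr : 0 < r) (hT : 0 < T) (f : ℝ → Wave → ℝ) :
    ¬ IsStrongSolution β M T (fun k => r * datum M A N k) f := by
  refine not_isStrongSolution (c := r ^ 3 * (c * A ^ 2)) (G := r * (2 * A * 2 ^ (M / 4))) hβ hβ' hM
    (by positivity) (by positivity) ((measurable_datum M A N).const_mul r) (fun k => ?_)
    (fun S => ?_) hT f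
  · rw [abs_mul, abs_of_pos hr, mul_assoc]
    exact mul_le_mul_of_nonneg_left (abs_datum_le (by linarith) hA N k) hr.le
  · refine ⟨{k | max R S < ‖k‖} ∩ {k | 1 - η < Real.cos (N * ‖k‖ ^ 2)}, ?_, fun k hk => ?_⟩
    · obtain ⟨k, hk1, hk2⟩ := exists_norm_sq_eq (R := max R S) N hN
      have hk3 : 1 - η < Real.cos (N * ‖k‖ ^ 2) := by linarith
      have ho : IsOpen ({k : Wave | max R S < ‖k‖} ∩ {k | 1 - η < Real.cos (N * ‖k‖ ^ 2)}) :=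
        (isOpen_lt (by fun_prop) (by fun_prop)).inter (isOpen_lt (by fun_prop) (by fun_prop))
      exact (ho.measure_pos volume ⟨k, hk1, hk3⟩).ne'
    · have h1 : max R S < ‖k‖ := hk.1
      have h2 : 1 - η < Real.cos (N * ‖k‖ ^ 2) := hk.2
      refine ⟨(le_max_right _ _).trans h1.le, ?_⟩
      rw [collision_const_mul]
      have := mul_le_mul_of_nonneg_left (h k ((le_max_left _ _).trans h1.le) h2.le)
        (show 0 ≤ r ^ 3 by positivity)
      linarith

lemma memW_datum {M A : ℝ} (hM : 0 ≤ M) (hA : 2 ≤ A) (N : ℕ) : MemW M (datum M A N) :=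
  memW_of_abs_le (measurable_datum M A N) (abs_datum_le hM hA N)

lemma wNorm_const_mul {M r : ℝ} (hr : 0 ≤ r) (f : Wave → ℝ) :
    wNorm M (fun k => r * f k) = ENNReal.ofReal r * wNorm M f := by
  unfold wNorm
  rw [← Real.enorm_of_nonneg hr, ← eLpNorm_const_smul]
  congr 1
  funext k
  simp only [Pi.smul_apply, smul_eq_mul]
  ring

lemma wNorm_datum_ne_zero {M A : ℝ} (hA : 2 ≤ A) (N : ℕ) : wNorm M (datum M A N) ≠ 0 := by
  intro h
  have hm := measurable_datum M A N
  rw [wNorm, eLpNorm_eq_zero_iff (by fun_prop) (by simp)] at h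
  obtain ⟨k, hk⟩ := h.exists
  exact (mul_pos (Real.rpow_pos_of_pos (bracket_pos k) M) (datum_pos hA N k)).ne' hk

end KineticWave

end

theorem mainTheorem3 (β M : ℝ) (hβ : 1 / 4 < β) (hβ' : β ≤ 1) (hM : 10 < M) :
    -- ill-posedness, for data of every prescribed size
    (∀ δ : ℝ, 0 < δ → ∃ f₀ : KineticWave.Wave → ℝ,
      KineticWave.MemW M f₀ ∧ KineticWave.wNorm M f₀ = ENNReal.ofReal δ ∧
        ∀ T : ℝ, 0 < T → ¬ ∃ f : ℝ → KineticWave.Wave → ℝ,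
          KineticWave.IsStrongSolution β M T f₀ f) ∧
    -- the explicit data, with the lower bound on the collision operator
    ∃ c : ℝ, 0 < c ∧ ∃ A₀ : ℝ, 0 < A₀ ∧ ∃ N₀ : ℕ, 0 < N₀ ∧
      ∀ A : ℝ, A₀ ≤ A → ∀ N : ℕ, N₀ ≤ N →
        KineticWave.MemW M (KineticWave.datum M A N) ∧
        (∃ B₀ : ℕ, ∀ B : ℕ, B₀ ≤ B → ∀ k : KineticWave.Wave,
          ‖k‖ ^ 2 = 2 * Real.pi * B / N →
            c * A ^ 2 * (‖k‖ ^ 2) ^ (2 * β - 1 / 2 - M / 2) ≤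
              |KineticWave.collision β (KineticWave.datum M A N) k|) ∧
        ∀ r : ℝ, 0 < r → ∀ T : ℝ, 0 < T → ¬ ∃ f : ℝ → KineticWave.Wave → ℝ,
          KineticWave.IsStrongSolution β M T
            (fun k => r * KineticWave.datum M A N k) f := by
  obtain ⟨c, η, hc, hη, hcol⟩ := KineticWave.exists_collision_datum_le hβ hβ' hM
  have hM0 : 0 ≤ M := by linarith
  have hill : ∀ A : ℝ, 2 ≤ A → ∀ N : ℕ, 4 ≤ N → ∀ r : ℝ, 0 < r → ∀ T : ℝ, 0 < T →
      ¬ ∃ f : ℝ → KineticWave.Wave → ℝ, KineticWave.IsStrongSolution β M T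
        (fun k => r * KineticWave.datum M A N k) f := by
    rintro A hA N hN r hr T hT ⟨f, hf⟩
    obtain ⟨R, hR⟩ := hcol A hA
    exact KineticWave.datum_not_isStrongSolution hβ hβ' hM hc hη hA (by omega)
      (fun k => hR N k hN) hr hT f hf
  refine ⟨fun δ hδ => ?_, c, hc, 2, by norm_num, 4, by norm_num, fun A hA N hN =>
    ⟨KineticWave.memW_datum hM0 hA N, ?_, hill A hA N hN⟩⟩
  · have hmem := KineticWave.memW_datum hM0 (le_refl (2 : ℝ)) 4
    have hfin : KineticWave.wNorm M (KineticWave.datum M 2 4) ≠ ⊤ := hmem.2.ne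
    have hpos := ENNReal.toReal_pos (KineticWave.wNorm_datum_ne_zero (M := M) (le_refl (2 : ℝ)) 4)
      hfin
    set n := (KineticWave.wNorm M (KineticWave.datum M 2 4)).toReal with hn
    refine ⟨fun k => δ / n * KineticWave.datum M 2 4 k, ?_, ?_,
      fun T hT => hill 2 le_rfl 4 le_rfl (δ / n) (by positivity) T hT⟩
    · refine KineticWave.memW_of_abs_le (G := δ / n * (2 * 2 * 2 ^ (M / 4)))
        ((KineticWave.measurable_datum M 2 4).const_mul _) fun k => ?_
      rw [abs_mul, abs_of_pos (by positivity), mul_assoc]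
      exact mul_le_mul_of_nonneg_left (KineticWave.abs_datum_le hM0 le_rfl 4 k) (by positivity)
    · rw [KineticWave.wNorm_const_mul (by positivity), ← ENNReal.ofReal_toReal hfin, ← hn,
        ← ENNReal.ofReal_mul (by positivity)]
      congr 1
      field_simp
  · obtain ⟨R, hR⟩ := hcol A hA
    have hN0 : (0 : ℝ) < N := by
      have : 0 < N := by omega
      exact_mod_cast this
    obtain ⟨B₀, hB₀⟩ := exists_nat_gt (N * R ^ 2 / (2 * Real.pi))
    refine ⟨B₀, fun B hB k hk => ?_⟩
    have hBB : (B₀ : ℝ) ≤ B := by exact_mod_cast hB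
    have hkR : R ≤ ‖k‖ := by
      refine le_of_sq_le_sq ?_ (norm_nonneg _)
      rw [hk, le_div_iff₀ hN0]
      rw [div_lt_iff₀ (by positivity)] at hB₀
      nlinarith [Real.pi_pos]
    have hcos : Real.cos (N * ‖k‖ ^ 2) = 1 := by
      rw [hk, show (N : ℝ) * (2 * Real.pi * B / N) = B * (2 * Real.pi) by field_simp,
        Real.cos_nat_mul_two_pi]
    have h := hR N k hN hkR (by rw [hcos]; linarith)
    rw [← Real.rpow_two ‖k‖, ← Real.rpow_mul (norm_nonneg k),
      show 2 * (2 * β - 1 / 2 - M / 2) = 4 * β - 1 - M by ring]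
    exact le_trans (by linarith) (neg_le_abs _)
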